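/- Let $\Gamma$ be a group with a finite symmetric generating set $S$, and let $G$ be its Cayley graph, in which distinct $x,y\in\Gamma$ are adjacent if and only if $x^{-1}y\in S$. Let $\mu=(\mu_k)_{k\ge 0}$ be a probability distribution on $\{0,1,2,\dots\}$ and let $q$ be a probability measure on $S\cup\{e\}$ that is symmetric, i.e. $q(s)=q(s^{-1})$ for all $s$. The unimodular branching random walk (UBRW) with offspring law $\mu$ and driving measure $q$ is defined as follows. Its family tree $\mathbb{T}$ is a random rooted tree with independent numbers of offspring: the root has $k+1$ children with probability proportional to $\mu_k/(k+1)$, $k\ge 0$, and every other vertex has $k$ children with probability $\mu_k$. The edges of $\mathbb{T}$ carry independent labels with law $q$, independent of $\mathbb{T}$. The root particle is at $e$, and the position of any other particle is the position of its parent multiplied on the right by the label of the edge joining them. The UBRW is called transient if, almost surely, every finite subset of $\Gamma$ is eventually free of particles, i.e. contains no particle of generation $n$ for all sufficiently large $n$. The trace $\mathtt{Tr}$ is the random subgraph of $G$ formed by all visited vertices and all traversed edges. The ends of a locally finite graph $H$ are the equivalence classes of its rays (infinite sequences of distinct, consecutively adjacent vertices), where two rays are equivalent if for every finite vertex set $F$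 they end up in the same connected component of $H\setminus F$. The space of ends has the topology in which, for every end $w$, the sets of all ends that end up in the same component of $H\setminus F$ as $w$, with $F$ a finite vertex set, form a neighbourhood base of $w$. An end is isolated if it is an isolated point of this space. If the UBRW is transient, then almost surely the following holds: if $\mathtt{Tr}$ has at least $3$ ends, then $\mathtt{Tr}$ has no isolated end. -/

import Mathlib

open MeasureTheory Filter
open scoped ENNReal

/-! ### Rays and ends of a graph -/

namespace GraphEnds

variable {V : Type*} (G : SimpleGraph V)

/-- A ray: an infinite sequence of distinct vertices, consecutive ones being adjacent. -/
structure Ray where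
  /-- the sequence of vertices -/
  vert : ℕ → V
  injective : Function.Injective vert
  adj : ∀ n, G.Adj (vert n) (vert (n + 1))

variable {G}

/-- The ray `π` ends up in the component `C` of the complement of `F`: all but finitely many of
its vertices lie in `C`. -/
def Ray.EndsUpIn (π : Ray G) {F : Set V} (C : G.ComponentCompl F) : Prop :=
  ∀ᶠ n in atTop, π.vert n ∈ C

/-- A ray ends up in some component of the complement of any finite set. -/
theorem Ray.exists_endsUpIn (π : Ray G) (F : Finset V) :
    ∃ C : G.ComponentCompl (F : Set V), π.EndsUpIn C := by
  have hfin : (π.vert ⁻¹' (F : Set V)).Finite := F.finite_toSet.preimage π.injective.injOn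
  obtain ⟨b, hb⟩ := hfin.bddAbove
  have hout : ∀ n, b + 1 ≤ n → π.vert n ∉ (F : Set V) := by
    intro n hn hmem
    have := hb hmem
    omega
  refine ⟨G.componentComplMk (hout (b + 1) le_rfl), eventually_atTop.2 ⟨b + 1, ?_⟩⟩
  intro n hn
  induction n, hn using Nat.le_induction with
  | base => exact G.componentComplMk_mem _
  | succ n hn ih =>
    exact SimpleGraph.ComponentCompl.mem_of_adj _ _ ih (hout _ (by omega)) (π.adj n)

/-- A ray ends up in at most one component of the complement of a given set. -/
theorem Ray.endsUpIn_unique (π : Ray G) {F : Set V} {C D : G.ComponentCompl F}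
    (hC : π.EndsUpIn C) (hD : π.EndsUpIn D) : C = D := by
  obtain ⟨n, ⟨_, h1⟩, ⟨_, h2⟩⟩ := (hC.and hD).exists
  exact h1.symm.trans h2

/-- Two rays are equivalent if, for every finite set `F` of vertices, they end up in the same
connected component of the complement of `F`. -/
instance raySetoid (G : SimpleGraph V) : Setoid (Ray G) where
  r π π' := ∀ F : Finset V, ∃ C : G.ComponentCompl (F : Set V), π.EndsUpIn C ∧ π'.EndsUpIn C
  iseqv :=
    { refl := fun π F => (π.exists_endsUpIn F).imp fun _ h => ⟨h, h⟩
      symm := fun h F => (h F).imp fun _ h => h.symm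
      trans := by
        intro π₁ π₂ π₃ h h' F
        obtain ⟨C, hC₁, hC₂⟩ := h F
        obtain ⟨D, hD₂, hD₃⟩ := h' F
        obtain rfl := π₂.endsUpIn_unique hC₂ hD₂
        exact ⟨C, hC₁, hD₃⟩ }

/-- The set of ends of `G`: equivalence classes of rays. -/
def Ends (G : SimpleGraph V) : Type _ := Quotient (raySetoid G)

/-- The end represented by a ray. -/
def Ray.toEnd (π : Ray G) : Ends G := Quotient.mk (raySetoid G) π

theorem Ray.toEnd_surjective : Function.Surjective (Ray.toEnd : Ray G → Ends G) :=
  Quotient.mk_surjective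

/-- The set of ends whose rays end up in the component `C` of the complement of a finite set. -/
def endsOf {F : Finset V} (C : G.ComponentCompl (F : Set V)) : Set (Ends G) :=
  {w | ∃ π : Ray G, π.toEnd = w ∧ π.EndsUpIn C}

theorem toEnd_mem_endsOf {F : Finset V} (C : G.ComponentCompl (F : Set V)) (π : Ray G) :
    π.toEnd ∈ endsOf C ↔ π.EndsUpIn C := by
  refine ⟨?_, fun h => ⟨π, rfl, h⟩⟩
  rintro ⟨π', h, hC⟩
  obtain ⟨D, hD, hD'⟩ := Quotient.exact h F
  obtain rfl := π'.endsUpIn_unique hC hD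
  exact hD'

/-- The topology on the space of ends: the sets `endsOf C` with `w ∈ endsOf C`, for `C` a component
of the complement of a finite set, are a neighbourhood base of the end `w`. -/
instance endsTopology (G : SimpleGraph V) : TopologicalSpace (Ends G) where
  IsOpen U := ∀ w ∈ U, ∃ (F : Finset V) (C : G.ComponentCompl (F : Set V)),
    w ∈ endsOf C ∧ endsOf C ⊆ U
  isOpen_univ := by
    intro w _
    obtain ⟨π, rfl⟩ := Ray.toEnd_surjective w
    obtain ⟨C, hC⟩ := π.exists_endsUpIn ∅
    exact ⟨∅, C, (toEnd_mem_endsOf C π).2 hC, Set.subset_univ _⟩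
  isOpen_inter := by
    classical
    intro U U' hU hU' w hw
    obtain ⟨F, C, hwC, hC⟩ := hU w hw.1
    obtain ⟨F', C', hwC', hC'⟩ := hU' w hw.2
    have key : ∀ {K L : Finset V} (h : (K : Set V) ⊆ (L : Set V))
        (D : G.ComponentCompl (L : Set V)) (E : G.ComponentCompl (K : Set V)) (π : Ray G),
        π.EndsUpIn D → π.EndsUpIn E → endsOf D ⊆ endsOf E := by
      intro K L h D E π hD hE
      have hsub : ∀ {ρ : Ray G}, ρ.EndsUpIn D → ρ.EndsUpIn (D.hom h) :=
        fun hρ => hρ.mono fun n hn => D.subset_hom h hn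
      obtain rfl := π.endsUpIn_unique hE (hsub hD)
      rintro _ ⟨ρ, rfl, hρ⟩
      exact ⟨ρ, rfl, hsub hρ⟩
    obtain ⟨π, rfl⟩ := Ray.toEnd_surjective w
    rw [toEnd_mem_endsOf] at hwC hwC'
    obtain ⟨D, hD⟩ := π.exists_endsUpIn (F ∪ F')
    refine ⟨F ∪ F', D, (toEnd_mem_endsOf D π).2 hD, Set.subset_inter ?_ ?_⟩
    · exact (key (by simp) D C π hD hwC).trans hC
    · exact (key (by simp) D C' π hD hwC').trans hC'
  isOpen_sUnion := by
    rintro s hs w ⟨U, hU, hw⟩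
    obtain ⟨F, C, hwC, hC⟩ := hs U hU w hw
    exact ⟨F, C, hwC, hC.trans (Set.subset_sUnion_of_mem hU)⟩

/-- An isolated end: an isolated point of the space of ends. -/
def IsIsolated (w : Ends G) : Prop := IsOpen ({w} : Set (Ends G))

end GraphEnds

/-! ### Unimodular branching random walks

Particles are addressed by words `v : List ℕ`; the root particle is `[]` and the children of `v`
are the words `i :: v` with `i` smaller than the number of offspring of `v`. A sample
`ω : List ℕ → ℕ × Γ` gives for every word `v` the number `(ω v).1` of offspring of `v` and
the label `(ω v).2` of the edge from the parent of `v` to `v` (unused for the root). -/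

namespace UBRW

/-- The weights of the number of children (that is, the degree) of the root of the unimodular
Galton-Watson tree: `k + 1` has weight `μ k / (k + 1)`, and `0` has weight zero. -/
noncomputable def rootWeight (μ : PMF ℕ) : ℕ → ℝ≥0∞
  | 0 => 0
  | k + 1 => μ k / ((k + 1 : ℕ) : ℝ≥0∞)

theorem tsum_rootWeight_ne_zero (μ : PMF ℕ) : ∑' n, rootWeight μ n ≠ 0 := by
  intro h
  rw [ENNReal.tsum_eq_zero] at h
  obtain ⟨k, hk⟩ := μ.support_nonempty
  rw [PMF.mem_support_iff] at hk
  have := h (k + 1)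
  simp only [rootWeight, ENNReal.div_eq_zero_iff] at this
  exact this.elim hk (ENNReal.natCast_ne_top _)

theorem tsum_rootWeight_ne_top (μ : PMF ℕ) : ∑' n, rootWeight μ n ≠ ∞ := by
  rw [tsum_eq_zero_add' ENNReal.summable]
  have : ∑' k, rootWeight μ (k + 1) ≤ ∑' k, μ k := by
    refine ENNReal.tsum_le_tsum fun k => ENNReal.div_le_of_le_mul ?_
    exact le_mul_of_one_le_right' (by exact_mod_cast Nat.succ_le_succ (Nat.zero_le k))
  rw [μ.tsum_coe] at this
  simpa [rootWeight] using ne_top_of_le_ne_top ENNReal.one_ne_top this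

/-- The law of the number of children of the root of the unimodular Galton-Watson tree with
offspring law `μ`: the probability of `k + 1` is proportional to `μ k / (k + 1)`. -/
noncomputable def rootLaw (μ : PMF ℕ) : PMF ℕ :=
  PMF.normalize (rootWeight μ) (tsum_rootWeight_ne_zero μ) (tsum_rootWeight_ne_top μ)

/-- The offspring law of the particle `v` in the unimodular Galton-Watson tree: the biased law for
the root, and `μ` for every other particle. -/
noncomputable def offspringLaw (μ : PMF ℕ) : List ℕ → PMF ℕ
  | [] => rootLaw μ
  | _ :: _ => μ

variable {Γ : Type*} [Group Γ]

/-- The law of the UBRW with offspring law `μ` and driving measure `q`: all offspring numbers and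
all steps are independent, with the laws `offspringLaw μ v` and `q`. -/
noncomputable def law [MeasurableSpace Γ] (μ : PMF ℕ) (q : PMF Γ) :
    Measure (List ℕ → ℕ × Γ) :=
  Measure.infinitePi fun v => (offspringLaw μ v).toMeasure.prod q.toMeasure

instance [MeasurableSpace Γ] (μ : PMF ℕ) (q : PMF Γ) : IsProbabilityMeasure (law μ q) := by
  unfold law
  infer_instance

/-- The word `v` belongs to the family tree. -/
def IsParticle (ω : List ℕ → ℕ × Γ) : List ℕ → Prop
  | [] => True
  | i :: v => i < (ω v).1 ∧ IsParticle ω v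

/-- The position of a particle: the root sits at the group identity, and `i :: v` sits at the
position of `v` times the label of the edge from `v` to `i :: v`. -/
def position (ω : List ℕ → ℕ × Γ) : List ℕ → Γ
  | [] => 1
  | i :: v => position ω v * (ω (i :: v)).2

/-- The UBRW is transient: almost surely, every finite set is eventually free of particles. -/
def IsTransient [MeasurableSpace Γ] (μ : PMF ℕ) (q : PMF Γ) : Prop :=
  ∀ᵐ ω ∂(law μ q), ∀ F : Finset Γ, ∃ N : ℕ, ∀ v : List ℕ,
    IsParticle ω v → N ≤ v.length → position ω v ∉ F

/-- Some particle has traversed an edge from `x` to `y`. -/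
def Traversed (ω : List ℕ → ℕ × Γ) (x y : Γ) : Prop :=
  ∃ (i : ℕ) (v : List ℕ), IsParticle ω (i :: v) ∧ position ω v = x ∧ position ω (i :: v) = y

theorem Traversed.visited {ω : List ℕ → ℕ × Γ} {x y : Γ} (h : Traversed ω x y) :
    (∃ v, IsParticle ω v ∧ position ω v = x) ∧ ∃ v, IsParticle ω v ∧ position ω v = y := by
  obtain ⟨i, v, hv, hx, hy⟩ := h
  exact ⟨⟨v, hv.2, hx⟩, ⟨i :: v, hv, hy⟩⟩

/-- The trace: the subgraph of the Cayley graph of `Γ` with respect to `S` that consists of the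
visited vertices and of the edges that are traversed in at least one direction. -/
def trace (S : Set Γ) (ω : List ℕ → ℕ × Γ) : (SimpleGraph.mulCayley S).Subgraph where
  verts := {x | ∃ v, IsParticle ω v ∧ position ω v = x}
  Adj x y := (SimpleGraph.mulCayley S).Adj x y ∧ (Traversed ω x y ∨ Traversed ω y x)
  adj_sub h := h.1
  edge_vert h := h.2.elim (fun h => h.visited.1) (fun h => h.visited.2)
  symm := ⟨fun _ _ h => ⟨h.1.symm, h.2.symm⟩⟩

end UBRW

/-!
The trace depends only on the unrooted family tree and on the positions of the particles up to a
common left translation, and the law of the tree does not change when its root is moved. More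
precisely, biasing the law of the UBRW by the degree of the root gives the product measure
`biasedLaw`, under which a root edge joins two independent Galton-Watson trees. This measure is
invariant under exchanging two children of the root (`measurePreserving_swap`) and, since `q` is
symmetric, under moving the root to its child `[0]` (`measurePreserving_flip`). Both laws are
mutually absolutely continuous, and only `law ≪ biasedLaw` is needed.

Let `B` be a measurable set of particles that is defined equivariantly. A branch of the family tree,
that is, one of the two halves into which an edge cuts it, is barren if it is infinite and contains
no element of `B`. Let every vertex `x` that is the starting point of a barren branch send mass one
to its neighbor at the other end of the cut edge. If `B` is nonempty, then this neighbor is unique,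
and a vertex that sends mass also receives mass, because a barren branch at `x` contains a smaller
one at a neighbor of `x`. The expected mass sent (weighted by the inverse degree) equals the expected
mass received, so that almost surely a root that receives mass also sends mass
(`Invariant.ae_coBarren`). If there were a barren branch and the root belonged to `B`, then on the
path from the root to this branch there would be a vertex that receives mass without sending any.
Hence almost surely, if the root is in `B`, then no branch is barren (`Invariant.ae_not_barren`).

This is applied to the set `B` of all particles `v` such that the translate of `F` by the position
of `v` is connected in the trace and separates it into at least three infinite parts, for each of
the countably many finite `F ⊆ Γ` (`TriSeparated`). If the trace has three ends, then the root
belongs to `B` for some `F` (`exists_triSeparated_nil`). If there is also an isolated end, then it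
is the only end of a component `C` of the complement of a connected finite set `K`. By
transience, some infinite branch of the family tree stays in `C`, so far from `K` that the
translates of `F` do not meet `K`. Such a translate has no more than two infinite parts in its
complement, as otherwise two of them would lie in `C` and Kőnig's lemma would give two ends there
(`not_triSeparating_of_isolated`). So the branch is barren (`exists_barren_of_isIsolated`).
-/

namespace UBRW

/-! ### Changing the root of the family tree -/

/-- The bijection of words under which the tree rooted at `[]` is rerooted at the child `[0]`: the
old root becomes the child `[0]` of the new one, the children of `[0]` become the children `[j + 1]`
of the new root, and the other children `[j + 1]` of the old root become its children `[j, 0]`. -/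
def flipWord : List ℕ → List ℕ
  | [] => [0]
  | [0] => []
  | [j + 1] => [j, 0]
  | [i, 0] => [i + 1]
  | i :: v => i :: flipWord v

/-- The bijection of words that exchanges the branches at the children `[0]` and `[i]`. -/
def swapWord (i : ℕ) : List ℕ → List ℕ
  | [] => []
  | [a] => [Equiv.swap 0 i a]
  | a :: v => a :: swapWord i v

theorem singleton_suffix_concat_iff {i j : ℕ} {w : List ℕ} : [i] <:+ w ++ [j] ↔ i = j := by
  constructor
  · rintro ⟨t, ht⟩
    simpa using (List.append_inj' ht rfl).2
  · rintro rfl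
    exact ⟨w, rfl⟩

theorem flipWord_cons {v : List ℕ} (i : ℕ) (h : v ≠ []) (h0 : v ≠ [0]) :
    flipWord (i :: v) = i :: flipWord v := by
  rcases v with _ | ⟨a, _ | ⟨b, v⟩⟩
  · exact absurd rfl h
  · rcases a with _ | a
    · exact absurd rfl h0
    · simp [flipWord]
  · simp [flipWord]

theorem swapWord_cons (i : ℕ) {v : List ℕ} (a : ℕ) (h : v ≠ []) :
    swapWord i (a :: v) = a :: swapWord i v := by
  cases v with
  | nil => exact absurd rfl h
  | cons b v => simp [swapWord]

theorem flipWord_flipWord (v : List ℕ) : flipWord (flipWord v) = v := by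
  induction v with
  | nil => simp [flipWord]
  | cons i v ih =>
    by_cases h : v = []
    · subst h
      cases i <;> simp [flipWord]
    by_cases h0 : v = [0]
    · subst h0
      simp [flipWord]
    rw [flipWord_cons i h h0, flipWord_cons i _ _, ih]
    · intro h'
      rw [h'] at ih
      exact h0 ih.symm
    · intro h'
      rw [h'] at ih
      exact h ih.symm

theorem swapWord_swapWord (i : ℕ) (v : List ℕ) : swapWord i (swapWord i v) = v := by
  induction v with
  | nil => simp [swapWord]
  | cons a v ih =>
    by_cases h : v = []
    · subst h
      simp [swapWord]
    rw [swapWord_cons i a h, swapWord_cons i a _, ih]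
    intro h'
    rw [h'] at ih
    exact h ih.symm

theorem flipWord_append (a : List ℕ) {v : List ℕ} (hv : 2 ≤ v.length) :
    flipWord (a ++ v) = a ++ flipWord v := by
  induction a with
  | nil => rfl
  | cons i a ih =>
    rw [List.cons_append, flipWord_cons, ih, List.cons_append]
    · intro h
      have := congrArg List.length h
      rw [List.length_append, List.length_nil] at this
      omega
    · intro h
      have := congrArg List.length h
      rw [List.length_append, List.length_singleton] at this
      omega

theorem swapWord_append (i : ℕ) (a : List ℕ) {v : List ℕ} (hv : v ≠ []) :
    swapWord i (a ++ v) = a ++ swapWord i v := by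
  induction a with
  | nil => rfl
  | cons b a ih => rw [List.cons_append, swapWord_cons, ih, List.cons_append]; simp [hv]

theorem length_swapWord (i : ℕ) (v : List ℕ) : (swapWord i v).length = v.length := by
  rcases v.eq_nil_or_concat with rfl | ⟨w, a, rfl⟩
  · rfl
  · simp [swapWord_append, swapWord]

theorem suffix_swapWord_iff (i j : ℕ) (v : List ℕ) :
    [Equiv.swap 0 i j] <:+ swapWord i v ↔ [j] <:+ v := by
  rcases v.eq_nil_or_concat with rfl | ⟨w, a, rfl⟩
  · simp [swapWord]
  · simp [swapWord_append, swapWord]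

theorem zero_suffix_swapWord_iff (i : ℕ) (v : List ℕ) : [0] <:+ swapWord i v ↔ [i] <:+ v := by
  rw [← suffix_swapWord_iff i i, Equiv.swap_apply_right]

theorem word_cases (v : List ℕ) :
    v = [] ∨ (∃ i, v = [i]) ∨ ∃ w i j, v = w ++ [i, j] := by
  rcases v.eq_nil_or_concat with rfl | ⟨w, a, rfl⟩
  · exact Or.inl rfl
  rcases w.eq_nil_or_concat with rfl | ⟨w, b, rfl⟩
  · exact Or.inr (Or.inl ⟨a, rfl⟩)
  · exact Or.inr (Or.inr ⟨w, b, a, by simp⟩)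

theorem zero_suffix_flipWord_iff (v : List ℕ) : [0] <:+ flipWord v ↔ ¬ [0] <:+ v := by
  rcases word_cases v with rfl | ⟨i, rfl⟩ | ⟨w, i, j, rfl⟩
  · simp [flipWord]
  · cases i with
    | zero => simp [flipWord]
    | succ i => simp [flipWord, List.suffix_cons_iff]
  · rw [flipWord_append _ (by simp)]
    cases j with
    | zero =>
      rw [show w ++ flipWord [i, 0] = w ++ [i + 1] by simp [flipWord],
        show w ++ [i, 0] = (w ++ [i]) ++ [0] by simp, singleton_suffix_concat_iff,
        singleton_suffix_concat_iff]
      simp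
    | succ j =>
      rw [show w ++ flipWord [i, j + 1] = (w ++ [i, j]) ++ [0] by simp [flipWord],
        show w ++ [i, j + 1] = (w ++ [i]) ++ [j + 1] by simp, singleton_suffix_concat_iff,
        singleton_suffix_concat_iff]
      simp

/-- Particles behind the child `[k + 1]` of the new root were behind the child `[0]` of the old
one. -/
theorem zero_suffix_of_suffix_flipWord {v : List ℕ} {k : ℕ} (h : [k + 1] <:+ flipWord v) :
    [0] <:+ v := by
  by_contra h0
  rw [← zero_suffix_flipWord_iff] at h0
  obtain ⟨a, ha⟩ := h
  obtain ⟨b, hb⟩ := h0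
  rw [← hb] at ha
  simp at ha

/-! ### Isomorphisms of family trees -/

/-- One of the two words is the parent of the other. -/
def Neighbors (u v : List ℕ) : Prop := (∃ i, u = i :: v) ∨ ∃ i, v = i :: u

variable {Γ : Type*}

/-- `TreeIso ω ω' e g` says that the involution `e` of words is an isomorphism of the unrooted family
trees of `ω` and of `ω'`, under which positions are translated by `g` on the left. -/
structure TreeIso [Group Γ] (ω ω' : List ℕ → ℕ × Γ) (e : List ℕ → List ℕ) (g : Γ) : Prop where
  involutive : Function.Involutive e
  isParticle : ∀ v, IsParticle ω' (e v) ↔ IsParticle ω v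
  position : ∀ v, position ω' (e v) = g * position ω v
  neighbors : ∀ u v, Neighbors u v → Neighbors (e u) (e v)

/-- The sample rerooted at the child `[0]` of the root. The label of the edge from `[]` to `[0]` is
inverted; the unused label of the root is left in place. -/
def flip [Group Γ] (ω : List ℕ → ℕ × Γ) (v : List ℕ) : ℕ × Γ :=
  if v = [] then ((ω [0]).1 + 1, (ω []).2)
  else if v = [0] then ((ω []).1 - 1, (ω [0]).2⁻¹)
  else ω (flipWord v)

/-- The sample in which the branches at the children `[0]` and `[i]` of the root are exchanged. -/
def swap (i : ℕ) (ω : List ℕ → ℕ × Γ) (v : List ℕ) : ℕ × Γ := ω (swapWord i v)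

theorem isParticle_of_suffix {ω : List ℕ → ℕ × Γ} {u v : List ℕ} (h : u <:+ v)
    (hv : IsParticle ω v) : IsParticle ω u := by
  obtain ⟨a, rfl⟩ := h
  induction a with
  | nil => exact hv
  | cons i a ih => exact ih hv.2

theorem flip_flipWord [Group Γ] (ω : List ℕ → ℕ × Γ) {v : List ℕ} (h : v ≠ []) (h0 : v ≠ [0]) :
    flip ω (flipWord v) = ω v := by
  have h1 : flipWord v ≠ [] := fun h' => h0 (by rw [← flipWord_flipWord v, h']; rfl)
  have h2 : flipWord v ≠ [0] := fun h' => h (by rw [← flipWord_flipWord v, h']; rfl)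
  rw [flip, if_neg h1, if_neg h2, flipWord_flipWord]

theorem treeIso_flip [Group Γ] (ω : List ℕ → ℕ × Γ) (hω : 0 < (ω []).1) :
    TreeIso ω (flip ω) flipWord (ω [0]).2⁻¹ where
  involutive := flipWord_flipWord
  isParticle v := by
    induction v with
    | nil => simp [flipWord, IsParticle, flip]
    | cons i v ih =>
      by_cases h : v = []
      · subst h
        cases i with
        | zero => simp [flipWord, IsParticle, hω]
        | succ i => simp [flipWord, IsParticle, flip]; omega
      by_cases h0 : v = [0]
      · subst h0
        simp [flipWord, IsParticle, hω, flip]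
      · rw [flipWord_cons i h h0, IsParticle, IsParticle, ih, flip_flipWord ω h h0]
  position v := by
    induction v with
    | nil => simp [flipWord, position, flip]
    | cons i v ih =>
      by_cases h : v = []
      · subst h
        cases i with
        | zero => simp [flipWord, position]
        | succ i => simp [flipWord, position, flip]
      by_cases h0 : v = [0]
      · subst h0
        simp [flipWord, position, flip]
      · have h1 := flipWord_cons i h h0
        rw [h1, position, position, ih, mul_assoc, ← h1, flip_flipWord ω (by simp) (by simp [h])]
  neighbors u v huv := by
    have key : ∀ i v, Neighbors (flipWord (i :: v)) (flipWord v) := by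
      intro i v
      by_cases h : v = []
      · subst h
        cases i <;> simp [flipWord, Neighbors]
      by_cases h0 : v = [0]
      · subst h0
        simp [flipWord, Neighbors]
      · exact Or.inl ⟨i, flipWord_cons i h h0⟩
    rcases huv with ⟨i, rfl⟩ | ⟨i, rfl⟩
    · exact key i v
    · exact (key i u).symm

theorem treeIso_swap [Group Γ] (ω : List ℕ → ℕ × Γ) {i : ℕ} (hi : i < (ω []).1) :
    TreeIso ω (swap i ω) (swapWord i) 1 where
  involutive := swapWord_swapWord i
  isParticle v := by
    induction v with
    | nil => simp [swapWord, IsParticle]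
    | cons a v ih =>
      by_cases h : v = []
      · subst h
        simp only [swapWord, IsParticle, swap, and_true]
        rcases eq_or_ne a 0 with rfl | ha
        · simp [hi]; omega
        rcases eq_or_ne a i with rfl | hai
        · simp [hi]; omega
        · rw [Equiv.swap_apply_of_ne_of_ne ha hai]
      · rw [swapWord_cons i a h, IsParticle, IsParticle, ih, swap, swapWord_swapWord]
  position v := by
    induction v with
    | nil => simp [swapWord, position]
    | cons a v ih =>
      by_cases h : v = []
      · subst h
        simp [swapWord, position, swap]
      · have h1 := swapWord_cons i a h
        rw [h1, position, position, ih, mul_assoc, ← h1, swap, swapWord_swapWord]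
  neighbors u v huv := by
    have key : ∀ a v, Neighbors (swapWord i (a :: v)) (swapWord i v) := by
      intro a v
      by_cases h : v = []
      · subst h
        exact Or.inl ⟨_, rfl⟩
      · exact Or.inl ⟨a, swapWord_cons i a h⟩
    rcases huv with ⟨a, rfl⟩ | ⟨a, rfl⟩
    · exact key a v
    · exact (key a u).symm

@[simp] theorem swap_nil (i : ℕ) (ω : List ℕ → ℕ × Γ) : swap i ω [] = ω [] := rfl

end UBRW

namespace UBRW

/-! ### Product measures -/

section InfinitePi

variable {ι : Type*} {X : ι → Type*} [∀ i, MeasurableSpace (X i)]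

theorem measurable_update_prod [DecidableEq ι] (i : ι) :
    Measurable fun p : X i × (∀ j, X j) => Function.update p.2 i p.1 := by
  rw [measurable_pi_iff]
  intro j
  by_cases hj : j = i
  · subst hj
    simpa using measurable_fst
  · simp only [Function.update_of_ne hj]
    fun_prop

/-- Changing one factor of a product measure amounts to resampling one coordinate. -/
theorem map_update_infinitePi [DecidableEq ι] (ν ν' : ∀ i, Measure (X i))
    [∀ i, IsProbabilityMeasure (ν i)] [∀ i, IsProbabilityMeasure (ν' i)] (i : ι)
    (h : ∀ j, j ≠ i → ν' j = ν j) :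
    ((ν' i).prod (Measure.infinitePi ν)).map (fun p => Function.update p.2 i p.1) =
      Measure.infinitePi ν' := by
  apply Measure.eq_infinitePi
  intro s t ht
  have hm := measurable_update_prod (X := X) i
  rw [Measure.map_apply hm (MeasurableSet.pi s.countable_toSet fun j _ => ht j)]
  have hpre : (fun p : X i × (∀ j, X j) => Function.update p.2 i p.1) ⁻¹' (Set.pi s t) =
      (if i ∈ s then t i else Set.univ) ×ˢ Set.pi (s.erase i : Finset ι) t := by
    ext ⟨x, ω⟩
    simp only [Set.mem_preimage, Set.mem_pi, Finset.mem_coe, Set.mem_prod, Finset.mem_erase]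
    constructor
    · intro hω
      refine ⟨?_, fun j hj => by simpa [hj.1] using hω j hj.2⟩
      split_ifs with hi
      · simpa using hω i hi
      · trivial
    · rintro ⟨hx, hω⟩ j hj
      by_cases hji : j = i
      · subst hji
        simpa [hj] using hx
      · simpa [hji] using hω j ⟨hji, hj⟩
  rw [hpre, Measure.prod_prod, Measure.infinitePi_pi _ fun j _ => ht j]
  have hprod : ∏ j ∈ s.erase i, ν j (t j) = ∏ j ∈ s.erase i, ν' j (t j) :=
    Finset.prod_congr rfl fun j hj => by rw [h j (Finset.ne_of_mem_erase hj)]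
  rw [hprod]
  split_ifs with hi
  · exact Finset.mul_prod_erase s (fun j => ν' j (t j)) hi
  · rw [measure_univ, one_mul, Finset.erase_eq_of_notMem hi]

theorem infinitePi_absolutelyContinuous [DecidableEq ι] (ν ν' : ∀ i, Measure (X i))
    [∀ i, IsProbabilityMeasure (ν i)] [∀ i, IsProbabilityMeasure (ν' i)] (i : ι)
    (h : ∀ j, j ≠ i → ν j = ν' j) (hi : ν i ≪ ν' i) :
    Measure.infinitePi ν ≪ Measure.infinitePi ν' := by
  have hm := measurable_update_prod (X := X) i
  have hprod : (ν i).prod (Measure.infinitePi ν') ≪ (ν' i).prod (Measure.infinitePi ν') :=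
    hi.prod Measure.AbsolutelyContinuous.rfl
  have := hprod.map hm
  rwa [map_update_infinitePi ν' ν i h, map_update_infinitePi ν' ν' i fun _ _ => rfl] at this

theorem measurePreserving_reindex {ι X : Type*} [MeasurableSpace X] (ν : ι → Measure X)
    [∀ i, IsProbabilityMeasure (ν i)] (e : Equiv.Perm ι) (h : ∀ i, ν (e i) = ν i) :
    MeasurePreserving (fun (ω : ι → X) i => ω (e i)) (Measure.infinitePi ν)
      (Measure.infinitePi ν) := by
  classical
  have hm : Measurable fun (ω : ι → X) i => ω (e i) := by fun_prop
  refine ⟨hm, Measure.eq_infinitePi _ ?_⟩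
  intro s t ht
  rw [Measure.map_apply hm (MeasurableSet.pi s.countable_toSet fun j _ => ht j)]
  have hpre : (fun (ω : ι → X) i => ω (e i)) ⁻¹' (Set.pi s t) =
      Set.pi (s.image e : Finset ι) fun i => t (e.symm i) := by
    ext ω
    simp only [Set.mem_preimage, Set.mem_pi, Finset.coe_image, Set.mem_image, Finset.mem_coe]
    exact ⟨fun hω => by rintro _ ⟨i, hi, rfl⟩; simpa using hω i hi,
      fun hω i hi => by simpa using hω (e i) ⟨i, hi, rfl⟩⟩
  rw [hpre, Measure.infinitePi_pi _ fun j _ => ht _, Finset.prod_image e.injective.injOn]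
  exact Finset.prod_congr rfl fun i _ => by rw [h, Equiv.symm_apply_apply]

end InfinitePi

/-! ### The degree-biased law -/

/-- The offspring law under which the root has one child more than an ordinary particle. Up to
normalization, this is the law of the unimodular Galton-Watson tree biased by the degree of the
root. -/
noncomputable def biasedOffspringLaw (μ : PMF ℕ) : List ℕ → PMF ℕ
  | [] => μ.map Nat.succ
  | _ :: _ => μ

variable {Γ : Type*} [MeasurableSpace Γ]

/-- The law of the UBRW biased by the degree of the root. -/
noncomputable def biasedLaw (μ : PMF ℕ) (q : PMF Γ) : Measure (List ℕ → ℕ × Γ) :=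
  Measure.infinitePi fun v => (biasedOffspringLaw μ v).toMeasure.prod q.toMeasure

instance (μ : PMF ℕ) (q : PMF Γ) : IsProbabilityMeasure (biasedLaw μ q) := by
  unfold biasedLaw
  infer_instance

theorem law_absolutelyContinuous (μ : PMF ℕ) (q : PMF Γ) : law μ q ≪ biasedLaw μ q := by
  classical
  refine infinitePi_absolutelyContinuous _ _ [] ?_ ?_
  · rintro (_ | ⟨i, v⟩) h
    · exact absurd rfl h
    · rfl
  · refine Measure.AbsolutelyContinuous.prod ?_ Measure.AbsolutelyContinuous.rfl
    refine Measure.AbsolutelyContinuous.mk fun s hs h => ?_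
    rw [PMF.toMeasure_apply_eq_zero_iff _ hs] at h ⊢
    refine h.mono_left fun n hn => ?_
    have hn' : rootWeight μ n ≠ 0 := by
      intro h0
      rw [PMF.mem_support_iff] at hn
      simp [offspringLaw, rootLaw, PMF.normalize_apply, h0] at hn
    cases n with
    | zero => exact absurd rfl hn'
    | succ k =>
      simp only [biasedOffspringLaw, PMF.support_map]
      refine ⟨k, ?_, rfl⟩
      rw [PMF.mem_support_iff]
      intro h0
      exact hn' (by simp [rootWeight, h0])

theorem ae_degree_pos (μ : PMF ℕ) (q : PMF Γ) : ∀ᵐ ω ∂(biasedLaw μ q), 0 < (ω []).1 := by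
  have h1 : ∀ᵐ n ∂(μ.map Nat.succ).toMeasure, 0 < n := by
    rw [ae_iff, PMF.toMeasure_apply_eq_zero_iff _ (MeasurableSet.of_discrete)]
    rw [Set.disjoint_left]
    intro n hn
    simp only [PMF.support_map] at hn
    obtain ⟨k, -, rfl⟩ := hn
    simp
  have h2 : ∀ᵐ x ∂((μ.map Nat.succ).toMeasure.prod q.toMeasure), 0 < x.1 :=
    Measure.quasiMeasurePreserving_fst.ae h1
  exact (measurePreserving_eval_infinitePi
    (fun v => (biasedOffspringLaw μ v).toMeasure.prod q.toMeasure) []).quasiMeasurePreserving.ae h2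

theorem measurePreserving_swap (μ : PMF ℕ) (q : PMF Γ) (i : ℕ) :
    MeasurePreserving (swap (Γ := Γ) i) (biasedLaw μ q) (biasedLaw μ q) := by
  refine measurePreserving_reindex _
    (Function.Involutive.toPerm (swapWord i) (swapWord_swapWord i)) ?_
  rintro (_ | ⟨a, _ | ⟨b, v⟩⟩) <;> rfl

/-- The two ends of an edge have independent offspring with the same law and, since `q` is symmetric,
inverting the label of the edge does not change its law. -/
theorem measurePreserving_flip_edge [Group Γ] [Countable Γ] [DiscreteMeasurableSpace Γ]
    (μ : PMF ℕ) (q : PMF Γ) (hq : ∀ g, q g⁻¹ = q g) :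
    MeasurePreserving
      (fun p : (ℕ × Γ) × (ℕ × Γ) => ((p.2.1 + 1, p.1.2), (p.1.1 - 1, p.2.2⁻¹)))
      (((μ.map Nat.succ).toMeasure.prod q.toMeasure).prod (μ.toMeasure.prod q.toMeasure))
      (((μ.map Nat.succ).toMeasure.prod q.toMeasure).prod (μ.toMeasure.prod q.toMeasure)) := by
  set ν := (μ.toMeasure.prod q.toMeasure).prod (μ.toMeasure.prod q.toMeasure) with hν
  have hsh : ((μ.map Nat.succ).toMeasure.prod q.toMeasure).prod (μ.toMeasure.prod q.toMeasure) =
      ν.map (Prod.map (Prod.map Nat.succ id) id) := by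
    rw [hν, ← Measure.map_prod_map _ _ (by fun_prop) (by fun_prop), Measure.map_id,
      ← Measure.map_prod_map _ _ (by fun_prop) (by fun_prop), Measure.map_id,
      PMF.toMeasure_map]
    fun_prop
  have hex : ν.map (fun p => ((p.2.1, p.1.2), (p.1.1, p.2.2⁻¹))) = ν := by
    refine Measure.ext_of_singleton fun ⟨⟨a, l⟩, ⟨b, m⟩⟩ => ?_
    rw [Measure.map_apply (by fun_prop) (measurableSet_singleton _)]
    have hpre : (fun p : (ℕ × Γ) × (ℕ × Γ) => ((p.2.1, p.1.2), (p.1.1, p.2.2⁻¹))) ⁻¹'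
        {((a, l), (b, m))} = {((b, l), (a, m⁻¹))} := by
      ext ⟨⟨a', l'⟩, ⟨b', m'⟩⟩
      simp only [Set.mem_preimage, Set.mem_singleton_iff, Prod.mk.injEq, inv_eq_iff_eq_inv]
      tauto
    rw [hpre]
    simp only [hν, ← Set.singleton_prod_singleton, Measure.prod_prod]
    simp only [PMF.toMeasure_apply_singleton _ _ (measurableSet_singleton _), hq]
    ring
  refine ⟨by fun_prop, ?_⟩
  rw [hsh, Measure.map_map (by fun_prop) (by fun_prop)]
  conv_rhs => rw [← hex]
  rw [Measure.map_map (by fun_prop) (by fun_prop)]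
  rfl

theorem measurePreserving_flip [Group Γ] [Countable Γ] [DiscreteMeasurableSpace Γ]
    (μ : PMF ℕ) (q : PMF Γ) (hq : ∀ g, q g⁻¹ = q g) :
    MeasurePreserving (flip (Γ := Γ)) (biasedLaw μ q) (biasedLaw μ q) := by
  have hm : Measurable (flip (Γ := Γ)) := by
    rw [measurable_pi_iff]
    intro v
    unfold flip
    split_ifs <;> fun_prop
  set ν := μ.toMeasure.prod q.toMeasure
  set ν₀ := (μ.map Nat.succ).toMeasure.prod q.toMeasure
  set P : Measure (List ℕ → ℕ × Γ) := Measure.infinitePi fun _ => ν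
  let U : ((ℕ × Γ) × (ℕ × Γ)) × (List ℕ → ℕ × Γ) → (List ℕ → ℕ × Γ) :=
    fun p => Function.update (Function.update p.2 [0] p.1.2) [] p.1.1
  have hU : MeasurePreserving U ((ν₀.prod ν).prod P) (biasedLaw μ q) := by
    have h1 : MeasurePreserving (fun p : (ℕ × Γ) × (List ℕ → ℕ × Γ) =>
        Function.update p.2 [0] p.1) (ν.prod P) P :=
      ⟨measurable_update_prod _, map_update_infinitePi (fun _ => ν) (fun _ => ν) [0] fun _ _ => rfl⟩
    have h2 : MeasurePreserving (fun p : (ℕ × Γ) × (List ℕ → ℕ × Γ) =>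
        Function.update p.2 [] p.1) (ν₀.prod P) (biasedLaw μ q) := by
      refine ⟨measurable_update_prod _, map_update_infinitePi (fun _ => ν)
        (fun v => (biasedOffspringLaw μ v).toMeasure.prod q.toMeasure) [] ?_⟩
      rintro (_ | ⟨i, v⟩) h
      · exact absurd rfl h
      · rfl
    exact h2.comp (((MeasurePreserving.id ν₀).prod h1).comp (measurePreserving_prodAssoc ν₀ ν P))
  have hG : MeasurePreserving (Prod.map
      (fun p : (ℕ × Γ) × (ℕ × Γ) => ((p.2.1 + 1, p.1.2), (p.1.1 - 1, p.2.2⁻¹)))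
      (fun (ω : List ℕ → ℕ × Γ) v => ω (flipWord v))) ((ν₀.prod ν).prod P) ((ν₀.prod ν).prod P) :=
    (measurePreserving_flip_edge μ q hq).prod (measurePreserving_reindex (fun _ => ν)
      (Function.Involutive.toPerm flipWord flipWord_flipWord) fun _ => rfl)
  have hcomm : flip ∘ U = U ∘ (Prod.map
      (fun p : (ℕ × Γ) × (ℕ × Γ) => ((p.2.1 + 1, p.1.2), (p.1.1 - 1, p.2.2⁻¹)))
      (fun (ω : List ℕ → ℕ × Γ) v => ω (flipWord v))) := by
    funext ⟨⟨x, y⟩, ω⟩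
    funext v
    by_cases h : v = []
    · subst h
      simp [flip, U]
    by_cases h0 : v = [0]
    · subst h0
      simp [flip, U]
    have h1 : flipWord v ≠ [] := fun h' => h0 (by rw [← flipWord_flipWord v, h']; rfl)
    have h2 : flipWord v ≠ [0] := fun h' => h (by rw [← flipWord_flipWord v, h']; rfl)
    simp [flip, U, h, h0, h1, h2]
  refine ⟨hm, ?_⟩
  conv_lhs => rw [← hU.map_eq]
  rw [Measure.map_map hm hU.measurable, hcomm, ← Measure.map_map hU.measurable hG.measurable,
    hG.map_eq, hU.map_eq]

end UBRW

namespace UBRW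

/-! ### Barren branches -/

variable {Γ : Type*}

theorem measurableSet_infinite {Ω ι : Type*} [MeasurableSpace Ω] [Countable ι] {s : Ω → Set ι}
    (h : ∀ i, MeasurableSet {ω | i ∈ s ω}) : MeasurableSet {ω | (s ω).Infinite} := by
  have : {ω | (s ω).Infinite} = ⋂ F : Finset ι, ⋃ i : ι, {ω | i ∉ F ∧ i ∈ s ω} := by
    ext ω
    simp only [Set.mem_iInter, Set.mem_iUnion]
    constructor
    · intro hω F
      obtain ⟨i, hi, hF⟩ := Set.Infinite.exists_notMem_finset hω F
      exact ⟨i, hF, hi⟩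
    · intro hω hfin
      obtain ⟨i, hF, hi⟩ := hω hfin.toFinset
      exact hF (hfin.mem_toFinset.2 hi)
  rw [this]
  exact MeasurableSet.iInter fun F => MeasurableSet.iUnion fun i =>
    (MeasurableSet.const _).inter (h i)

theorem measurableSet_isParticle [MeasurableSpace Γ] (v : List ℕ) :
    MeasurableSet {ω : List ℕ → ℕ × Γ | IsParticle ω v} := by
  induction v with
  | nil => exact MeasurableSet.const True
  | cons i v ih =>
    exact (measurableSet_lt measurable_const (measurable_pi_apply v).fst).inter ih

theorem measurableSet_infinite_isParticle [MeasurableSpace Γ] (p : List ℕ → Prop) :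
    MeasurableSet {ω : List ℕ → ℕ × Γ | {w | IsParticle ω w ∧ p w}.Infinite} :=
  measurableSet_infinite fun w => (measurableSet_isParticle w).inter (MeasurableSet.const _)

/-- A measurable set `B ω` of particles that depends only on the unrooted family tree and on the
positions of the particles up to translation. -/
structure Invariant [Group Γ] [MeasurableSpace Γ] (B : (List ℕ → ℕ × Γ) → List ℕ → Prop) :
    Prop where
  isParticle : ∀ {ω v}, B ω v → IsParticle ω v
  treeIso : ∀ {ω ω' e g}, TreeIso ω ω' e g → ∀ v, B ω' (e v) ↔ B ω v
  measurableSet : ∀ v, MeasurableSet {ω | B ω v}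

/-- The branch of the family tree at `v` is infinite and free of `B`. -/
def Barren (B : (List ℕ → ℕ × Γ) → List ℕ → Prop) (ω : List ℕ → ℕ × Γ) (v : List ℕ) : Prop :=
  {w | IsParticle ω w ∧ v <:+ w}.Infinite ∧ ∀ w, v <:+ w → ¬ B ω w

/-- The branch at the root, seen from its child `[i]`, is infinite and free of `B`: this is the
condition `Barren` for the edge from `[]` to `[i]` traversed in the other direction. -/
def CoBarren (B : (List ℕ → ℕ × Γ) → List ℕ → Prop) (ω : List ℕ → ℕ × Γ) (i : ℕ) : Prop :=
  {w | IsParticle ω w ∧ ¬ [i] <:+ w}.Infinite ∧ ∀ w, ¬ [i] <:+ w → ¬ B ω w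

/-- The set `B` is nonempty and the branch at `[0]` is barren. -/
def barrenEvent (B : (List ℕ → ℕ × Γ) → List ℕ → Prop) : Set (List ℕ → ℕ × Γ) :=
  {ω | Barren B ω [0] ∧ ∃ w, B ω w}

/-- The set `B` is nonempty and the branch at the root, seen from `[0]`, is barren. -/
def coBarrenEvent (B : (List ℕ → ℕ × Γ) → List ℕ → Prop) : Set (List ℕ → ℕ × Γ) :=
  {ω | CoBarren B ω 0 ∧ ∃ w, B ω w}

theorem Barren.isParticle {B : (List ℕ → ℕ × Γ) → List ℕ → Prop} {ω : List ℕ → ℕ × Γ} {v : List ℕ}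
    (h : Barren B ω v) : IsParticle ω v := by
  obtain ⟨w, hw, hvw⟩ := h.1.nonempty
  exact isParticle_of_suffix hvw hw

/-- If the branch at the root, seen from `[i]`, is barren, then so is the branch at some child of the
root: finitely many branches make up an infinite set. -/
theorem CoBarren.exists_barren {B : (List ℕ → ℕ × Γ) → List ℕ → Prop}
    {ω : List ℕ → ℕ × Γ} {i : ℕ} (h : CoBarren B ω i) :
    ∃ j < (ω []).1, Barren B ω [j] := by
  by_contra! hno
  refine h.1 (Set.Finite.subset (s := insert [] (⋃ j ∈ Finset.range (ω []).1,
    {w | IsParticle ω w ∧ [j] <:+ w ∧ ¬ [i] <:+ w})) (Set.Finite.insert _ ?_) ?_)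
  · refine Set.Finite.biUnion (Finset.finite_toSet _) fun j hj => ?_
    by_cases hji : j = i
    · subst hji
      simp
    · have hj' : j < (ω []).1 := by simpa using hj
      by_contra hinf
      refine hno j hj' ⟨Set.Infinite.mono (fun w hw => ⟨hw.1, hw.2.1⟩) hinf, fun w hw => h.2 w ?_⟩
      rintro ⟨a, rfl⟩
      rw [singleton_suffix_concat_iff] at hw
      exact hji hw
  · rintro w ⟨hw, hiw⟩
    rcases w.eq_nil_or_concat with rfl | ⟨w, a, rfl⟩
    · exact Set.mem_insert _ _
    · rw [List.concat_eq_append] at hw hiw ⊢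
      have ha : IsParticle ω [a] := isParticle_of_suffix ⟨w, rfl⟩ hw
      refine Set.mem_insert_of_mem _ (Set.mem_biUnion (x := a) ?_ ⟨hw, ⟨w, rfl⟩, hiw⟩)
      simpa using ha.1

section Invariance

variable [Group Γ]

theorem TreeIso.infinite_iff {ω ω' : List ℕ → ℕ × Γ} {e : List ℕ → List ℕ} {g : Γ}
    (h : TreeIso ω ω' e g) {p p' : List ℕ → Prop} (hp : ∀ v, p' (e v) ↔ p v) :
    {w | IsParticle ω' w ∧ p' w}.Infinite ↔ {w | IsParticle ω w ∧ p w}.Infinite := by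
  have himg : {w | IsParticle ω' w ∧ p' w} = e '' {w | IsParticle ω w ∧ p w} := by
    ext w
    constructor
    · rintro ⟨hw, hpw⟩
      rw [← h.involutive w] at hw hpw
      exact ⟨e w, ⟨(h.isParticle _).1 hw, (hp _).1 hpw⟩, h.involutive w⟩
    · rintro ⟨v, ⟨hv, hpv⟩, rfl⟩
      exact ⟨(h.isParticle v).2 hv, (hp v).2 hpv⟩
  rw [himg, Set.infinite_image_iff h.involutive.injective.injOn]

variable [MeasurableSpace Γ] {B : (List ℕ → ℕ × Γ) → List ℕ → Prop}

theorem Invariant.forall_iff (hB : Invariant B) {ω ω' : List ℕ → ℕ × Γ} {e : List ℕ → List ℕ}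
    {g : Γ} (h : TreeIso ω ω' e g) {p p' : List ℕ → Prop} (hp : ∀ v, p' (e v) ↔ p v) :
    (∀ w, p' w → ¬ B ω' w) ↔ ∀ w, p w → ¬ B ω w := by
  constructor
  · intro H w hw hBw
    exact H (e w) ((hp w).2 hw) ((hB.treeIso h w).2 hBw)
  · intro H w hw hBw
    rw [← h.involutive w] at hw hBw
    exact H (e w) ((hp _).1 hw) ((hB.treeIso h _).1 hBw)

theorem Invariant.exists_iff (hB : Invariant B) {ω ω' : List ℕ → ℕ × Γ} {e : List ℕ → List ℕ}
    {g : Γ} (h : TreeIso ω ω' e g) : (∃ w, B ω' w) ↔ ∃ w, B ω w := by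
  constructor
  · rintro ⟨w, hw⟩
    rw [← h.involutive w] at hw
    exact ⟨e w, (hB.treeIso h _).1 hw⟩
  · rintro ⟨w, hw⟩
    exact ⟨e w, (hB.treeIso h _).2 hw⟩

theorem Invariant.flip_mem_barrenEvent_iff (hB : Invariant B) {ω : List ℕ → ℕ × Γ}
    (hω : 0 < (ω []).1) : flip ω ∈ barrenEvent B ↔ ω ∈ coBarrenEvent B :=
  have h := treeIso_flip ω hω
  and_congr (and_congr (h.infinite_iff zero_suffix_flipWord_iff)
    (hB.forall_iff h zero_suffix_flipWord_iff)) (hB.exists_iff h)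

theorem Invariant.swap_mem_barrenEvent_iff (hB : Invariant B) {ω : List ℕ → ℕ × Γ} {i : ℕ}
    (hi : i < (ω []).1) : swap i ω ∈ barrenEvent B ↔ Barren B ω [i] ∧ ∃ w, B ω w :=
  have h := treeIso_swap ω hi
  and_congr (and_congr (h.infinite_iff (zero_suffix_swapWord_iff i))
    (hB.forall_iff h (zero_suffix_swapWord_iff i))) (hB.exists_iff h)

theorem Invariant.swap_mem_coBarrenEvent_iff (hB : Invariant B) {ω : List ℕ → ℕ × Γ} {i : ℕ}
    (hi : i < (ω []).1) : swap i ω ∈ coBarrenEvent B ↔ CoBarren B ω i ∧ ∃ w, B ω w :=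
  have h := treeIso_swap ω hi
  have hp := fun v => not_congr (zero_suffix_swapWord_iff i v)
  and_congr (and_congr (h.infinite_iff hp) (hB.forall_iff h hp)) (hB.exists_iff h)

theorem Invariant.measurableSet_exists (hB : Invariant B) : MeasurableSet {ω | ∃ w, B ω w} := by
  have : {ω | ∃ w, B ω w} = ⋃ w, {ω | B ω w} := by ext; simp
  rw [this]
  exact MeasurableSet.iUnion hB.measurableSet

theorem Invariant.measurableSet_forall (hB : Invariant B) (p : List ℕ → Prop) :
    MeasurableSet {ω | ∀ w, p w → ¬ B ω w} := by
  have : {ω | ∀ w, p w → ¬ B ω w} = ⋂ w, {ω | p w ∧ B ω w}ᶜ := by ext; simp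
  rw [this]
  exact MeasurableSet.iInter fun w => ((MeasurableSet.const _).inter (hB.measurableSet w)).compl

theorem Invariant.measurableSet_barrenEvent (hB : Invariant B) : MeasurableSet (barrenEvent B) :=
  ((measurableSet_infinite_isParticle _).inter (hB.measurableSet_forall _)).inter
    hB.measurableSet_exists

theorem Invariant.measurableSet_coBarrenEvent (hB : Invariant B) :
    MeasurableSet (coBarrenEvent B) :=
  ((measurableSet_infinite_isParticle _).inter (hB.measurableSet_forall _)).inter
    hB.measurableSet_exists

end Invariance

/-! ### Mass transport along the edges at the root -/

/-- The children of the root are exchangeable: the probability of an event that concerns the child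
`[0]` is the expected proportion of the children of the root for which the event occurs. -/
theorem lintegral_sum_swap [MeasurableSpace Γ] (μ : PMF ℕ) (q : PMF Γ) {E : Set (List ℕ → ℕ × Γ)}
    (hE : MeasurableSet E) :
    ∫⁻ ω, (∑ i ∈ Finset.range (ω []).1, E.indicator 1 (swap i ω)) / ((ω []).1 : ℝ≥0∞)
      ∂(biasedLaw μ q) = biasedLaw μ q E := by
  have hdeg : Measurable fun ω : List ℕ → ℕ × Γ => (ω []).1 := (measurable_pi_apply _).fst
  have hdeg' : Measurable fun ω : List ℕ → ℕ × Γ => ((ω []).1 : ℝ≥0∞) :=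
    (measurable_of_countable (fun n : ℕ => (n : ℝ≥0∞))).comp hdeg
  have hmE : Measurable (E.indicator (1 : (List ℕ → ℕ × Γ) → ℝ≥0∞)) :=
    measurable_one.indicator hE
  let f : ℕ → (List ℕ → ℕ × Γ) → ℝ≥0∞ := fun i ω =>
    (if i < (ω []).1 then E.indicator 1 ω else 0) / ((ω []).1 : ℝ≥0∞)
  have hf : ∀ i, Measurable (f i) := fun i =>
    (Measurable.ite (measurableSet_lt measurable_const hdeg) hmE measurable_const).div hdeg'
  have hsum : ∀ (a : ℕ → ℝ≥0∞) (n : ℕ),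
      (∑ i ∈ Finset.range n, a i) / (n : ℝ≥0∞) =
        ∑' i, (if i < n then a i else 0) / (n : ℝ≥0∞) := by
    intro a n
    simp only [div_eq_mul_inv, ENNReal.tsum_mul_right]
    congr 1
    rw [tsum_eq_sum (s := Finset.range n)]
    · exact Finset.sum_congr rfl fun i hi => by rw [if_pos (Finset.mem_range.1 hi)]
    · intro i hi
      rw [if_neg (by simpa using hi)]
  calc _ = ∫⁻ ω, ∑' i, f i (swap i ω) ∂(biasedLaw μ q) :=
        lintegral_congr fun ω => hsum _ _
    _ = ∑' i, ∫⁻ ω, f i (swap i ω) ∂(biasedLaw μ q) :=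
        lintegral_tsum fun i => ((hf i).comp (measurePreserving_swap μ q i).measurable).aemeasurable
    _ = ∑' i, ∫⁻ ω, f i ω ∂(biasedLaw μ q) := by
        congr 1
        funext i
        exact (measurePreserving_swap μ q i).lintegral_comp (hf i)
    _ = ∫⁻ ω, ∑' i, f i ω ∂(biasedLaw μ q) :=
        (lintegral_tsum fun i => (hf i).aemeasurable).symm
    _ = ∫⁻ ω, E.indicator 1 ω ∂(biasedLaw μ q) := by
        refine lintegral_congr_ae ?_
        filter_upwards [ae_degree_pos μ q] with ω hω
        rw [← hsum (fun _ => E.indicator 1 ω) (ω []).1, Finset.sum_const, Finset.card_range,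
          nsmul_eq_mul, mul_comm, ENNReal.mul_div_cancel_right]
        · exact_mod_cast hω.ne'
        · exact ENNReal.natCast_ne_top _
    _ = biasedLaw μ q E := lintegral_indicator_one hE

variable [Group Γ] [MeasurableSpace Γ] {B : (List ℕ → ℕ × Γ) → List ℕ → Prop}

/-- Every vertex `x` that is the first one of a barren branch with respect to its neighbor `y` sends
mass one to `y`, which is unique if `B` is nonempty. Then every vertex receives at least as much mass
as it sends, so that both are almost surely equal: if the root receives mass from a child, then it
sends mass to a child. -/
theorem Invariant.ae_coBarren [Countable Γ] [DiscreteMeasurableSpace Γ] (hB : Invariant B)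
    (μ : PMF ℕ) (q : PMF Γ) (hq : ∀ g, q g⁻¹ = q g) :
    ∀ᵐ ω ∂(biasedLaw μ q), ∀ i, Barren B ω [i] → (∃ w, B ω w) → ∃ j < (ω []).1, CoBarren B ω j := by
  have hdeg : Measurable fun ω : List ℕ → ℕ × Γ => ((ω []).1 : ℝ≥0∞) :=
    (measurable_of_countable (fun n : ℕ => (n : ℝ≥0∞))).comp (measurable_pi_apply _).fst
  let X : Set (List ℕ → ℕ × Γ) → (List ℕ → ℕ × Γ) → ℝ≥0∞ := fun E ω =>
    ∑ i ∈ Finset.range (ω []).1, E.indicator 1 (swap i ω)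
  have hX : Measurable (X (barrenEvent B)) := by
    have hfun : X (barrenEvent B) = fun ω => ∑' i, if i < (ω []).1 then
        (barrenEvent B).indicator 1 (swap i ω) else 0 := by
      funext ω
      rw [tsum_eq_sum (s := Finset.range (ω []).1)]
      · exact Finset.sum_congr rfl fun i hi => by rw [if_pos (Finset.mem_range.1 hi)]
      · intro i hi
        rw [if_neg (by simpa using hi)]
    rw [hfun]
    refine Measurable.tsum fun i => Measurable.ite
      (measurableSet_lt measurable_const (measurable_pi_apply _).fst) ?_ measurable_const
    exact (measurable_one.indicator hB.measurableSet_barrenEvent).comp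
      (measurePreserving_swap μ q i).measurable
  have hmeas : biasedLaw μ q (barrenEvent B) = biasedLaw μ q (coBarrenEvent B) := by
    rw [← (measurePreserving_flip μ q hq).measure_preimage
      hB.measurableSet_barrenEvent.nullMeasurableSet]
    refine measure_congr ?_
    filter_upwards [ae_degree_pos μ q] with ω hω
    exact propext (hB.flip_mem_barrenEvent_iff hω)
  have hle : ∀ ω, X (coBarrenEvent B) ω ≤ X (barrenEvent B) ω := by
    intro ω
    by_cases h0 : ∃ i ∈ Finset.range (ω []).1, swap i ω ∈ coBarrenEvent B
    · obtain ⟨i, hi, hiω⟩ := h0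
      have hi' := Finset.mem_range.1 hi
      obtain ⟨hco, w, hw⟩ := (hB.swap_mem_coBarrenEvent_iff hi').1 hiω
      obtain ⟨k, hk, hbk⟩ := hco.exists_barren
      have h1 : X (coBarrenEvent B) ω = 1 := by
        refine (Finset.sum_eq_single_of_mem i hi fun j hj hji => ?_).trans
          (Set.indicator_of_mem hiω _)
        refine Set.indicator_of_notMem (fun hjω => ?_) _
        -- If two children were such that `B` lies behind them only, then `B` would be empty.
        have hjo := ((hB.swap_mem_coBarrenEvent_iff (Finset.mem_range.1 hj)).1 hjω).1
        by_cases hiw : [i] <:+ w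
        · refine hjo.2 w (fun hjw => ?_) hw
          obtain ⟨a, rfl⟩ := hiw
          rw [singleton_suffix_concat_iff] at hjw
          exact hji hjw
        · exact hco.2 w hiw hw
      rw [h1]
      have h2 : (barrenEvent B).indicator (1 : (List ℕ → ℕ × Γ) → ℝ≥0∞) (swap k ω) = 1 :=
        Set.indicator_of_mem ((hB.swap_mem_barrenEvent_iff hk).2 ⟨hbk, w, hw⟩) _
      rw [← h2]
      exact Finset.single_le_sum
        (f := fun i => (barrenEvent B).indicator (1 : (List ℕ → ℕ × Γ) → ℝ≥0∞) (swap i ω))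
        (fun _ _ => zero_le) (Finset.mem_range.2 hk)
    · push Not at h0
      have : X (coBarrenEvent B) ω = 0 :=
        Finset.sum_eq_zero fun i hi => Set.indicator_of_notMem (h0 i hi) _
      rw [this]
      exact zero_le
  have hae := ae_eq_of_ae_le_of_lintegral_le (μ := biasedLaw μ q)
    (f := fun ω => X (coBarrenEvent B) ω / ((ω []).1 : ℝ≥0∞))
    (g := fun ω => X (barrenEvent B) ω / ((ω []).1 : ℝ≥0∞))
    (Eventually.of_forall fun ω => ENNReal.div_le_div_right (hle ω) _)
    (by rw [lintegral_sum_swap μ q hB.measurableSet_coBarrenEvent]; exact measure_ne_top _ _)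
    (hX.div hdeg).aemeasurable
    (by rw [lintegral_sum_swap μ q hB.measurableSet_coBarrenEvent,
          lintegral_sum_swap μ q hB.measurableSet_barrenEvent, hmeas])
  filter_upwards [hae] with ω hω i hi hne
  have hi' : i < (ω []).1 := hi.isParticle.1
  have hpos : X (barrenEvent B) ω / ((ω []).1 : ℝ≥0∞) ≠ 0 := by
    rw [Ne, ENNReal.div_eq_zero_iff, not_or]
    refine ⟨fun h0 => ?_, ENNReal.natCast_ne_top _⟩
    have := (Finset.sum_eq_zero_iff.1 h0) i (Finset.mem_range.2 hi')
    rw [Set.indicator_of_mem ((hB.swap_mem_barrenEvent_iff hi').2 ⟨hi, hne⟩)] at this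
    exact one_ne_zero this
  rw [← hω] at hpos
  by_contra! hno
  refine hpos ?_
  have : X (coBarrenEvent B) ω = 0 := by
    refine Finset.sum_eq_zero fun j hj => Set.indicator_of_notMem (fun hjω => ?_) _
    rw [hB.swap_mem_coBarrenEvent_iff (Finset.mem_range.1 hj)] at hjω
    exact hno j (Finset.mem_range.1 hj) hjω.1
  simp only [this, ENNReal.zero_div]

/-- The conclusion of `Invariant.ae_coBarren` for barren branches that start further away: rerooting
the tree along the path to the branch, one edge at a time, reduces to the case of an edge at the
root. -/
theorem Invariant.ae_one_sided [Countable Γ] [DiscreteMeasurableSpace Γ] (hB : Invariant B)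
    (μ : PMF ℕ) (q : PMF Γ) (hq : ∀ g, q g⁻¹ = q g) (n : ℕ) :
    ∀ᵐ ω ∂(biasedLaw μ q), ∀ v, v.length = n + 1 → Barren B ω v → (∃ w, B ω w) →
      ∃ j, ∀ w, B ω w → [j] <:+ w := by
  have h1 := hB.ae_coBarren μ q hq
  induction n with
  | zero =>
    filter_upwards [h1] with ω hω v hv hvB hne
    obtain ⟨i, rfl⟩ := List.length_eq_one_iff.1 hv
    obtain ⟨j, -, hj⟩ := hω i hvB hne
    exact ⟨j, fun w hw => by_contra fun hjw => hj.2 w hjw hw⟩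
  | succ n ih =>
    have hreroot : ∀ i : ℕ, ∀ᵐ ω ∂(biasedLaw μ q), ∀ v, v.length = n + 1 →
        Barren B (flip (swap i ω)) v → (∃ w, B (flip (swap i ω)) w) →
          ∃ j, ∀ w, B (flip (swap i ω)) w → [j] <:+ w := fun i =>
      ((measurePreserving_flip μ q hq).comp
        (measurePreserving_swap μ q i)).quasiMeasurePreserving.ae ih
    rw [← ae_all_iff] at hreroot
    filter_upwards [h1, hreroot] with ω hω hre v hv hvB hne
    rcases word_cases v with rfl | ⟨i, rfl⟩ | ⟨a, k, i, rfl⟩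
    · simp at hv
    · simp at hv
    have hi : i < (ω []).1 :=
      (isParticle_of_suffix (u := [i]) ⟨a ++ [k], by simp⟩ hvB.isParticle).1
    have hs := treeIso_swap ω hi
    have hf := treeIso_flip (swap i ω) (by rw [swap_nil]; omega)
    set e : List ℕ → List ℕ := fun w => flipWord (swapWord i w) with he
    have hBe : ∀ w, B (flip (swap i ω)) (e w) ↔ B ω w := fun w =>
      (hB.treeIso hf _).trans (hB.treeIso hs _)
    have hee : ∀ w, ∃ u, e u = w := fun w =>
      ⟨swapWord i (flipWord w), by rw [he]; simp only [swapWord_swapWord, flipWord_flipWord]⟩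
    have hev : ∀ b, e (b ++ (a ++ [k, i])) = b ++ (a ++ [k + 1]) := by
      intro b
      simp only [he]
      rw [← List.append_assoc, swapWord_append _ _ (by simp), flipWord_append]
      · simp [swapWord, flipWord]
      · rw [length_swapWord]
        rfl
    have hsuf : ∀ w, a ++ [k + 1] <:+ e w ↔ a ++ [k, i] <:+ w := by
      intro w
      constructor
      · rintro ⟨b, hb⟩
        rw [← hev b] at hb
        exact ⟨b, by
          have := congrArg (fun u => swapWord i (flipWord u)) hb
          simpa only [he, flipWord_flipWord, swapWord_swapWord] using this⟩
      · rintro ⟨b, rfl⟩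
        rw [hev]
        exact ⟨b, rfl⟩
    have hbar : Barren B (flip (swap i ω)) (a ++ [k + 1]) := by
      constructor
      · rw [hf.infinite_iff (p := fun w => a ++ [k + 1] <:+ flipWord w) fun _ => Iff.rfl,
          hs.infinite_iff (p := fun w => a ++ [k, i] <:+ w) hsuf]
        exact hvB.1
      · intro w hw hBw
        obtain ⟨u, rfl⟩ := hee w
        exact hvB.2 u ((hsuf u).1 hw) ((hBe u).1 hBw)
    obtain ⟨j, hj⟩ := hre i (a ++ [k + 1]) (by simpa using hv) hbar
      ((hB.exists_iff hf).2 ((hB.exists_iff hs).2 hne))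
    cases j with
    | zero =>
      -- `B` lies behind the old root, so that the branch at `[i]` is barren as well.
      have hbi : Barren B ω [i] := by
        refine ⟨hvB.1.mono fun w hw => ⟨hw.1, ?_⟩, fun w hiw hBw => ?_⟩
        · exact List.IsSuffix.trans ⟨a ++ [k], by simp⟩ hw.2
        · have h0 := hj (e w) ((hBe w).2 hBw)
          rw [zero_suffix_flipWord_iff, zero_suffix_swapWord_iff] at h0
          exact h0 hiw
      obtain ⟨j, -, hj⟩ := hω i hbi hne
      exact ⟨j, fun w hw => by_contra fun hjw => hj.2 w hjw hw⟩
    | succ j =>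
      refine ⟨i, fun w hw => ?_⟩
      rw [← zero_suffix_swapWord_iff]
      exact zero_suffix_of_suffix_flipWord (hj (e w) ((hBe w).2 hw))

/-- If the root belongs to an invariant set `B`, then almost surely every infinite branch of the
family tree meets `B`. -/
theorem Invariant.ae_not_barren [Countable Γ] [DiscreteMeasurableSpace Γ] (hB : Invariant B)
    (μ : PMF ℕ) (q : PMF Γ) (hq : ∀ g, q g⁻¹ = q g) :
    ∀ᵐ ω ∂(law μ q), B ω [] → ∀ v, ¬ Barren B ω v := by
  refine (law_absolutelyContinuous μ q).ae_le ?_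
  filter_upwards [ae_all_iff.2 (hB.ae_one_sided μ q hq)] with ω hω hroot v hv
  cases v with
  | nil => exact hv.2 [] List.suffix_rfl hroot
  | cons i v =>
    obtain ⟨j, hj⟩ := hω v.length (i :: v) rfl hv ⟨[], hroot⟩
    simpa using hj [] hroot

end UBRW

namespace UBRW

/-! ### Sets that separate the trace into three infinite parts -/

variable {Γ : Type*} [Group Γ]

/-- The trace as a graph on the whole group. Its only difference from `trace` is that unvisited
group elements are isolated vertices. -/
def walkGraph (ω : List ℕ → ℕ × Γ) : SimpleGraph Γ := SimpleGraph.fromRel (Traversed ω)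

/-- The subgraph of `walkGraph ω` formed by the edges that do not meet `K`. -/
def clearGraph (ω : List ℕ → ℕ × Γ) (K : Set Γ) : SimpleGraph Γ where
  Adj x y := (walkGraph ω).Adj x y ∧ x ∉ K ∧ y ∉ K
  symm := ⟨fun _ _ h => ⟨h.1.symm, h.2.2, h.2.1⟩⟩
  loopless := ⟨fun _ h => h.1.ne rfl⟩

/-- The set `K` is connected in the trace, and its removal leaves at least three infinite
components. -/
def TriSeparating (ω : List ℕ → ℕ × Γ) (K : Set Γ) : Prop :=
  (∀ a ∈ K, ∀ b ∈ K, (clearGraph ω Kᶜ).Reachable a b) ∧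
    ∃ a : Fin 3 → Γ, (∀ i, {y | (clearGraph ω K).Reachable (a i) y}.Infinite) ∧
      ∀ i j, i ≠ j → ¬ (clearGraph ω K).Reachable (a i) (a j)

/-- The left translate of `K` by `g`. -/
def translate (g : Γ) (K : Set Γ) : Set Γ := {y | g⁻¹ * y ∈ K}

/-- The particle `v` belongs to the family tree, and the translate of `F` by its position is
connected and separates the trace into at least three infinite parts. -/
def TriSeparated (F : Set Γ) (ω : List ℕ → ℕ × Γ) (v : List ℕ) : Prop :=
  IsParticle ω v ∧ TriSeparating ω (translate (position ω v) F)

theorem walkGraph_adj_iff {ω : List ℕ → ℕ × Γ} {x y : Γ} : (walkGraph ω).Adj x y ↔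
    x ≠ y ∧ ∃ u v, IsParticle ω u ∧ IsParticle ω v ∧ Neighbors u v ∧
      position ω u = x ∧ position ω v = y := by
  rw [walkGraph, SimpleGraph.fromRel_adj]
  refine and_congr_right fun _ => ?_
  constructor
  · rintro (⟨i, v, hv, hx, hy⟩ | ⟨i, v, hv, hx, hy⟩)
    · exact ⟨v, i :: v, hv.2, hv, Or.inr ⟨i, rfl⟩, hx, hy⟩
    · exact ⟨i :: v, v, hv, hv.2, Or.inl ⟨i, rfl⟩, hy, hx⟩
  · rintro ⟨u, v, hu, hv, ⟨i, rfl⟩ | ⟨i, rfl⟩, hx, hy⟩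
    · exact Or.inr ⟨i, v, hu, hy, hx⟩
    · exact Or.inl ⟨i, u, hv, hx, hy⟩

theorem TreeIso.symm {ω ω' : List ℕ → ℕ × Γ} {e : List ℕ → List ℕ} {g : Γ}
    (h : TreeIso ω ω' e g) : TreeIso ω' ω e g⁻¹ where
  involutive := h.involutive
  isParticle v := by rw [← h.isParticle, h.involutive]
  position v := by
    have := h.position (e v)
    rw [h.involutive] at this
    rw [this, inv_mul_cancel_left]
  neighbors := h.neighbors

theorem TreeIso.walkGraph_adj {ω ω' : List ℕ → ℕ × Γ} {e : List ℕ → List ℕ} {g : Γ}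
    (h : TreeIso ω ω' e g) {x y : Γ} (hxy : (walkGraph ω).Adj x y) :
    (walkGraph ω').Adj (g * x) (g * y) := by
  rw [walkGraph_adj_iff] at hxy ⊢
  obtain ⟨hne, u, v, hu, hv, huv, rfl, rfl⟩ := hxy
  exact ⟨fun h' => hne (mul_left_cancel h'), e u, e v, (h.isParticle u).2 hu, (h.isParticle v).2 hv,
    h.neighbors u v huv, h.position u, h.position v⟩

theorem TreeIso.reachable {ω ω' : List ℕ → ℕ × Γ} {e : List ℕ → List ℕ} {g : Γ}
    (h : TreeIso ω ω' e g) {K : Set Γ} {x y : Γ} (hxy : (clearGraph ω K).Reachable x y) :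
    (clearGraph ω' (translate g K)).Reachable (g * x) (g * y) := by
  let f : clearGraph ω K →g clearGraph ω' (translate g K) :=
    { toFun := fun x => g * x
      map_rel' := fun hab => ⟨h.walkGraph_adj hab.1, by simpa [translate] using hab.2.1,
        by simpa [translate] using hab.2.2⟩ }
  exact hxy.map f

theorem translate_translate (g h : Γ) (K : Set Γ) :
    translate g (translate h K) = translate (g * h) K := by
  ext y
  simp [translate, mul_assoc]

theorem translate_one (K : Set Γ) : translate 1 K = K := by
  ext y
  simp [translate]

theorem TreeIso.reachable_iff {ω ω' : List ℕ → ℕ × Γ} {e : List ℕ → List ℕ} {g : Γ}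
    (h : TreeIso ω ω' e g) {K : Set Γ} {x y : Γ} :
    (clearGraph ω' (translate g K)).Reachable (g * x) (g * y) ↔
      (clearGraph ω K).Reachable x y := by
  refine ⟨fun h' => ?_, h.reachable⟩
  simpa [translate_translate, translate_one] using h.symm.reachable h'

theorem TreeIso.triSeparating {ω ω' : List ℕ → ℕ × Γ} {e : List ℕ → List ℕ} {g : Γ}
    (h : TreeIso ω ω' e g) {K : Set Γ} (hK : TriSeparating ω K) :
    TriSeparating ω' (translate g K) := by
  obtain ⟨hconn, a, hinf, hsep⟩ := hK
  refine ⟨fun x hx y hy => ?_, fun i => g * a i, fun i => ?_, fun i j hij => ?_⟩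
  · have := h.reachable (hconn _ hx _ hy)
    rwa [mul_inv_cancel_left, mul_inv_cancel_left] at this
  · refine ((Set.infinite_image_iff (mul_right_injective g).injOn).2 (hinf i)).mono ?_
    rintro _ ⟨y, hy, rfl⟩
    exact h.reachable hy
  · rw [h.reachable_iff]
    exact hsep i j hij

section Measurability

variable [MeasurableSpace Γ] [Countable Γ] [DiscreteMeasurableSpace Γ]

theorem measurable_reflTransGen {Ω α : Type*} [MeasurableSpace Ω] [Countable α]
    {r : Ω → α → α → Prop} (hr : ∀ a b, Measurable fun ω => r ω a b) (a b : α) :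
    Measurable fun ω => Relation.ReflTransGen (r ω) a b := by
  let p : ℕ → α → Ω → Prop := fun n => Nat.rec (fun b _ => a = b)
    (fun _ p b ω => ∃ c, p c ω ∧ r ω c b) n
  have hp : ∀ n b, Measurable (p n b) := by
    intro n
    induction n with
    | zero => exact fun b => measurable_const
    | succ n ih => exact fun b => Measurable.exists fun c => (ih c).and (hr c b)
  have hiff : (fun ω => Relation.ReflTransGen (r ω) a b) = fun ω => ∃ n, p n b ω := by
    funext ω
    refine propext ⟨fun h => ?_, ?_⟩
    · induction h with
      | refl => exact ⟨0, rfl⟩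
      | @tail c d _ hcd ih =>
        obtain ⟨n, hn⟩ := ih
        exact ⟨n + 1, c, hn, hcd⟩
    · rintro ⟨n, hn⟩
      induction n generalizing b with
      | zero =>
        obtain rfl : a = b := hn
        exact Relation.ReflTransGen.refl
      | succ n ih =>
        obtain ⟨c, hc, hcb⟩ := hn
        exact (ih c hc).tail hcb
  rw [hiff]
  exact Measurable.exists fun n => hp n b

theorem measurable_position (v : List ℕ) :
    Measurable fun ω : List ℕ → ℕ × Γ => position ω v := by
  induction v with
  | nil => exact measurable_const
  | cons i v ih =>
    exact (Measurable.of_discrete (f := fun p : Γ × Γ => p.1 * p.2)).comp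
      (ih.prodMk (measurable_pi_apply (i :: v)).snd)

theorem measurable_position_eq (v : List ℕ) (x : Γ) :
    Measurable fun ω : List ℕ → ℕ × Γ => position ω v = x :=
  measurableSet_setOfPred.1 (measurable_position v (measurableSet_singleton x))

theorem measurable_walkGraph_adj (x y : Γ) :
    Measurable fun ω : List ℕ → ℕ × Γ => (walkGraph ω).Adj x y := by
  have h : ∀ x y : Γ, Measurable fun ω : List ℕ → ℕ × Γ => Traversed ω x y := fun x y =>
    Measurable.exists fun i => Measurable.exists fun v =>
      (measurableSet_setOfPred.1 (measurableSet_isParticle _)).and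
        ((measurable_position_eq _ _).and (measurable_position_eq _ _))
  simp only [walkGraph, SimpleGraph.fromRel_adj]
  exact measurable_const.and ((h x y).or (h y x))

theorem measurable_reachable (K : Set Γ) (x y : Γ) :
    Measurable fun ω : List ℕ → ℕ × Γ => (clearGraph ω K).Reachable x y := by
  simp only [SimpleGraph.reachable_iff_reflTransGen]
  exact measurable_reflTransGen
    (fun a b => (measurable_walkGraph_adj a b).and (measurable_const.and measurable_const)) x y

theorem measurable_triSeparating (K : Set Γ) :
    Measurable fun ω : List ℕ → ℕ × Γ => TriSeparating ω K := by
  refine Measurable.and ?_ (Measurable.exists fun a => Measurable.and ?_ ?_)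
  · exact Measurable.forall fun a => measurable_const.imp <| Measurable.forall fun b =>
      measurable_const.imp <| measurable_reachable _ a b
  · exact Measurable.forall fun i => measurableSet_setOfPred.1 <|
      measurableSet_infinite fun y => measurableSet_setOfPred.2 <| measurable_reachable K (a i) y
  · exact Measurable.forall fun i => Measurable.forall fun j =>
      measurable_const.imp (measurable_reachable K _ _).not

theorem invariant_triSeparated (F : Set Γ) : Invariant (TriSeparated F) where
  isParticle h := h.1
  treeIso {ω ω' e g} h v := by
    have key : ∀ {ω ω' : List ℕ → ℕ × Γ} {e : List ℕ → List ℕ} {g : Γ}, TreeIso ω ω' e g →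
        ∀ v, TriSeparated F ω v → TriSeparated F ω' (e v) := by
      intro ω ω' e g h v hv
      refine ⟨(h.isParticle v).2 hv.1, ?_⟩
      rw [h.position, ← translate_translate]
      exact h.triSeparating hv.2
    refine ⟨fun hv => ?_, key h v⟩
    have := key h.symm (e v) hv
    rwa [h.involutive] at this
  measurableSet v := by
    have : (fun ω : List ℕ → ℕ × Γ => TriSeparated F ω v) = fun ω => IsParticle ω v ∧
        ∃ x, position ω v = x ∧ TriSeparating ω (translate x F) := by
      funext ω
      simp [TriSeparated]
    rw [measurableSet_setOfPred, this]
    exact (measurableSet_setOfPred.1 (measurableSet_isParticle _)).and <| Measurable.exists fun x =>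
      (measurable_position_eq v x).and (measurable_triSeparating _)

end Measurability

end UBRW

namespace UBRW

/-! ### Kőnig's lemma -/

/-- Kőnig's lemma: in a locally finite graph, a geodesic ray starts at every vertex of an infinite
component. -/
theorem exists_seq_of_infinite_component {V : Type*} (H : SimpleGraph V)
    (hfin : ∀ x, {y | H.Adj x y}.Finite) {a : V} (ha : {y | H.Reachable a y}.Infinite) :
    ∃ f : ℕ → V, Function.Injective f ∧ f 0 = a ∧ ∀ n, H.Adj (f n) (f (n + 1)) := by
  -- the vertices that geodesics from `a` reach through `x`
  let D : V → Set V := fun x => {z | H.Reachable x z ∧ H.dist a z = H.dist a x + H.dist x z}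
  let P : V → Prop := fun x => H.Reachable a x ∧ (D x).Infinite
  have hstep : ∀ x, P x → ∃ y, H.Adj x y ∧ H.dist a y = H.dist a x + 1 ∧ P y := by
    rintro x ⟨hax, hx⟩
    by_contra! hno
    refine hx (Set.Finite.subset (s := insert x (⋃ y ∈ {y | H.Adj x y},
      {z | H.dist a y = H.dist a x + 1 ∧ z ∈ D y})) (Set.Finite.insert _ ?_) ?_)
    · refine (hfin x).biUnion fun y hy => ?_
      by_cases hd : H.dist a y = H.dist a x + 1
      · refine Set.Finite.subset (s := D y) ?_ fun z hz => hz.2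
        by_contra hinf
        exact hno y hy hd ⟨hax.trans (SimpleGraph.Adj.reachable hy), hinf⟩
      · exact Set.Finite.subset Set.finite_empty fun z hz => hd hz.1
    · rintro z ⟨hxz, hz⟩
      obtain ⟨p, hp⟩ := hxz.exists_walk_length_eq_dist
      cases p with
      | nil => exact Set.mem_insert _ _
      | @cons _ y _ hxy p =>
        refine Set.mem_insert_of_mem _ (Set.mem_biUnion (x := y) hxy ?_)
        have h1 : H.dist y z ≤ p.length := SimpleGraph.dist_le p
        have hyz : H.Reachable y z := ⟨p⟩
        have hay : H.Reachable a y := hax.trans hxy.reachable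
        have h2 := hay.dist_triangle_left z
        have h3 := hax.dist_triangle_left y
        have h4 : H.dist x y = 1 := SimpleGraph.dist_eq_one_iff_adj.2 hxy
        rw [SimpleGraph.Walk.length_cons] at hp
        exact ⟨by omega, hyz, by omega⟩
  choose! nxt hadj hdist hnext using hstep
  have hP0 : P a := by
    refine ⟨SimpleGraph.Reachable.refl a, ha.mono fun z hz => ⟨hz, ?_⟩⟩
    rw [SimpleGraph.dist_self, zero_add]
  let f : ℕ → V := fun n => nxt^[n] a
  have hsucc : ∀ n, f (n + 1) = nxt (f n) := fun n => Function.iterate_succ_apply' nxt n a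
  have hP : ∀ n, P (f n) := by
    intro n
    induction n with
    | zero => exact hP0
    | succ n ih => rw [hsucc]; exact hnext _ ih
  have hd : ∀ n, H.dist a (f n) = n := by
    intro n
    induction n with
    | zero => exact SimpleGraph.dist_self
    | succ n ih => rw [hsucc, hdist _ (hP n), ih]
  refine ⟨f, fun m n hmn => ?_, rfl, fun n => ?_⟩
  · rw [← hd m, ← hd n, hmn]
  · rw [hsucc]
    exact hadj _ (hP n)

/-! ### Ends of the trace -/

variable {Γ : Type*} [Group Γ] {ω : List ℕ → ℕ × Γ}

theorem clearGraph_mono {K L : Set Γ} (h : K ⊆ L) : clearGraph ω L ≤ clearGraph ω K :=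
  fun _ _ hxy => ⟨hxy.1, fun hx => hxy.2.1 (h hx), fun hy => hxy.2.2 (h hy)⟩

theorem notMem_of_reachable {K : Set Γ} {x y : Γ} (h : (clearGraph ω K).Reachable x y)
    (hx : x ∉ K) : y ∉ K := by
  rw [SimpleGraph.reachable_iff_reflTransGen] at h
  cases h with
  | refl => exact hx
  | tail _ h => exact h.2.2

theorem reachable_position_of_suffix {K : Set Γ} {u w : List ℕ} (hw : IsParticle ω w)
    (h : u <:+ w) (hK : ∀ v, u <:+ v → v <:+ w → position ω v ∉ K) :
    (clearGraph ω K).Reachable (position ω u) (position ω w) := by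
  obtain ⟨a, rfl⟩ := h
  induction a with
  | nil => exact SimpleGraph.Reachable.refl _
  | cons i a ih =>
    refine (ih hw.2 fun v hv hv' => hK v hv (hv'.trans (List.suffix_cons i _))).trans ?_
    by_cases heq : position ω (a ++ u) = position ω (i :: a ++ u)
    · rw [heq]
    · refine SimpleGraph.Adj.reachable ⟨?_, hK _ (List.suffix_append a u) (List.suffix_cons i _),
        hK _ (List.suffix_append (i :: a) u) List.suffix_rfl⟩
      exact walkGraph_adj_iff.2 ⟨heq, a ++ u, i :: (a ++ u), hw.2, hw, Or.inr ⟨i, rfl⟩, rfl, rfl⟩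

theorem walkGraph_adj_visited {x y : Γ} (h : (walkGraph ω).Adj x y) :
    ∃ v, IsParticle ω v ∧ position ω v = x := by
  obtain ⟨-, u, v, hu, -, -, hx, -⟩ := walkGraph_adj_iff.1 h
  exact ⟨u, hu, hx⟩

variable {S : Set Γ}

/-- If all labels lie in `S ∪ {e}`, then every traversed edge belongs to the Cayley graph. -/
theorem mulCayley_adj_of_traversed (hlab : ∀ v, (ω v).2 ∈ insert 1 S) {x y : Γ}
    (h : Traversed ω x y) (hne : x ≠ y) : (SimpleGraph.mulCayley S).Adj x y := by
  obtain ⟨i, v, hv, rfl, rfl⟩ := h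
  rw [SimpleGraph.mulCayley_adj']
  refine ⟨hne, (ω (i :: v)).2, ?_, Or.inl rfl⟩
  refine (hlab _).resolve_left fun h1 => hne ?_
  rw [position, h1, mul_one]

theorem mulCayley_adj_of_walkGraph_adj (hlab : ∀ v, (ω v).2 ∈ insert 1 S) {x y : Γ}
    (h : (walkGraph ω).Adj x y) : (SimpleGraph.mulCayley S).Adj x y := by
  rw [walkGraph, SimpleGraph.fromRel_adj] at h
  exact h.2.elim (fun ht => mulCayley_adj_of_traversed hlab ht h.1)
    fun ht => (mulCayley_adj_of_traversed hlab ht h.1.symm).symm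

theorem coe_trace_adj_iff (hlab : ∀ v, (ω v).2 ∈ insert 1 S) {x y : (trace S ω).verts} :
    (trace S ω).coe.Adj x y ↔ (walkGraph ω).Adj x.1 y.1 := by
  rw [SimpleGraph.Subgraph.coe_adj]
  constructor
  · intro h
    rw [walkGraph, SimpleGraph.fromRel_adj]
    exact ⟨h.1.ne, h.2⟩
  · intro h
    refine ⟨mulCayley_adj_of_walkGraph_adj hlab h, ?_⟩
    rw [walkGraph, SimpleGraph.fromRel_adj] at h
    exact h.2

theorem finite_walkGraph_adj (hS : S.Finite) (hlab : ∀ v, (ω v).2 ∈ insert 1 S) (x : Γ) :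
    {y | (walkGraph ω).Adj x y}.Finite := by
  refine ((hS.image fun s => x * s).union (hS.image fun s => x * s⁻¹)).subset fun y hy => ?_
  obtain ⟨-, s, hs, h | h⟩ := (SimpleGraph.mulCayley_adj' S x y).1
    (mulCayley_adj_of_walkGraph_adj hlab hy)
  · exact Or.inl ⟨s, hs, h⟩
  · refine Or.inr ⟨s, hs, ?_⟩
    simp [h]

open GraphEnds

/-- The vertices of the ray are eventually joined to `a` by paths of the trace that avoid `K`. -/
def EventuallyReachable (π : Ray (trace S ω).coe) (K : Set Γ) (a : Γ) : Prop :=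
  ∀ᶠ n in atTop, (clearGraph ω K).Reachable a (π.vert n).1

theorem EventuallyReachable.mono {π : Ray (trace S ω).coe} {K L : Set Γ} {a : Γ} (h : K ⊆ L)
    (hπ : EventuallyReachable π L a) : EventuallyReachable π K a :=
  Eventually.mono hπ fun _ hn => hn.mono (clearGraph_mono h)

theorem EventuallyReachable.reachable {π : Ray (trace S ω).coe} {K : Set Γ} {a b : Γ}
    (ha : EventuallyReachable π K a) (hb : EventuallyReachable π K b) :
    (clearGraph ω K).Reachable a b := by
  obtain ⟨n, h1, h2⟩ := (Eventually.and ha hb).exists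
  exact h1.trans h2.symm

theorem EventuallyReachable.trans {π : Ray (trace S ω).coe} {K : Set Γ} {a b : Γ}
    (h : (clearGraph ω K).Reachable a b) (hb : EventuallyReachable π K b) :
    EventuallyReachable π K a :=
  Eventually.mono hb fun _ hn => h.trans hn

theorem reachable_of_mem_component (hlab : ∀ v, (ω v).2 ∈ insert 1 S)
    {F : Set (trace S ω).verts} {C : (trace S ω).coe.ComponentCompl F}
    {K : Set Γ} (hK : ∀ x : (trace S ω).verts, x.1 ∈ K → x ∈ F)
    {x y : (trace S ω).verts} (hx : x ∈ C) (hy : y ∈ C) :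
    (clearGraph ω K).Reachable x.1 y.1 := by
  obtain ⟨hxF, rfl⟩ := hx
  obtain ⟨hyF, hy⟩ := hy
  have hr : ((trace S ω).coe.induce Fᶜ).Reachable ⟨x, hxF⟩ ⟨y, hyF⟩ :=
    (SimpleGraph.ConnectedComponent.eq.1 hy).symm
  let f : (trace S ω).coe.induce Fᶜ →g clearGraph ω K :=
    { toFun := fun z => z.1.1
      map_rel' := fun {z z'} hzz' => ⟨(coe_trace_adj_iff hlab).1 hzz', fun h => z.2 (hK _ h),
        fun h => z'.2 (hK _ h)⟩ }
  exact hr.map f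

theorem mem_component_of_reachable (hlab : ∀ v, (ω v).2 ∈ insert 1 S)
    {F : Set (trace S ω).verts} {C : (trace S ω).coe.ComponentCompl F}
    {K : Set Γ} (hK : ∀ x ∈ F, x.1 ∈ K) {x y : (trace S ω).verts} (hx : x ∈ C)
    (h : (clearGraph ω K).Reachable x.1 y.1) : y ∈ C := by
  rw [SimpleGraph.reachable_iff_reflTransGen] at h
  have key : ∀ z, Relation.ReflTransGen (clearGraph ω K).Adj x.1 z → ∃ hz, ⟨z, hz⟩ ∈ C := by
    intro z hz
    induction hz with
    | refl => exact ⟨x.2, hx⟩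
    | @tail b c _ hbc ih =>
      obtain ⟨hb, hbC⟩ := ih
      refine ⟨walkGraph_adj_visited hbc.1.symm, ?_⟩
      exact SimpleGraph.ComponentCompl.mem_of_adj _ _ hbC (fun h => hbc.2.2 (hK _ h))
        ((coe_trace_adj_iff hlab).2 hbc.1)
  exact (key _ h).2

theorem exists_eventuallyReachable (hlab : ∀ v, (ω v).2 ∈ insert 1 S) (π : Ray (trace S ω).coe)
    (K : Finset Γ) : ∃ n, EventuallyReachable π K (π.vert n).1 := by
  let F : Finset (trace S ω).verts := K.preimage Subtype.val Subtype.val_injective.injOn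
  have hK : ∀ x : (trace S ω).verts, x.1 ∈ (K : Set Γ) → x ∈ (F : Set (trace S ω).verts) :=
    fun x hx => by simpa [F] using hx
  obtain ⟨C, hC⟩ := π.exists_endsUpIn F
  obtain ⟨n, hn⟩ := hC.exists
  exact ⟨n, Eventually.mono hC fun m hm => reachable_of_mem_component hlab hK hn hm⟩

theorem exists_eventuallyReachable_of_toEnd_eq (hlab : ∀ v, (ω v).2 ∈ insert 1 S)
    {π ρ : Ray (trace S ω).coe} (h : π.toEnd = ρ.toEnd) (K : Finset Γ) :
    ∃ a, EventuallyReachable π K a ∧ EventuallyReachable ρ K a := by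
  let F : Finset (trace S ω).verts := K.preimage Subtype.val Subtype.val_injective.injOn
  have hK : ∀ x : (trace S ω).verts, x.1 ∈ (K : Set Γ) → x ∈ (F : Set (trace S ω).verts) :=
    fun x hx => by simpa [F] using hx
  obtain ⟨C, hπ, hρ⟩ := Quotient.exact h F
  obtain ⟨n, hn⟩ := hπ.exists
  exact ⟨(π.vert n).1, hπ.mono fun m hm => reachable_of_mem_component hlab hK hn hm,
    hρ.mono fun m hm => reachable_of_mem_component hlab hK hn hm⟩

theorem toEnd_eq_of_eventuallyReachable (hlab : ∀ v, (ω v).2 ∈ insert 1 S)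
    {π ρ : Ray (trace S ω).coe} (h : ∀ F : Finset (trace S ω).verts, ∃ a,
      EventuallyReachable π (Subtype.val '' (F : Set (trace S ω).verts)) a ∧
        EventuallyReachable ρ (Subtype.val '' (F : Set (trace S ω).verts)) a) :
    π.toEnd = ρ.toEnd := by
  refine Quotient.sound fun F => ?_
  obtain ⟨a, hπ, hρ⟩ := h F
  obtain ⟨C, hC⟩ := π.exists_endsUpIn F
  refine ⟨C, hC, ?_⟩
  obtain ⟨n, hn, hna⟩ := (Eventually.and hC hπ).exists
  exact Eventually.mono hρ fun m hm =>
    mem_component_of_reachable hlab (fun _ hx => Set.mem_image_of_mem _ hx) hn (hna.symm.trans hm)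

/-- A finite set of vertices that separates an isolated end from all other ends. -/
theorem exists_of_isIsolated (hlab : ∀ v, (ω v).2 ∈ insert 1 S) {w : Ends (trace S ω).coe}
    (hw : IsIsolated w) : ∃ (F : Finset (trace S ω).verts), ∃ π : Ray (trace S ω).coe, ∃ a,
      EventuallyReachable π (Subtype.val '' (F : Set (trace S ω).verts)) a ∧
      ∀ ρ : Ray (trace S ω).coe,
        EventuallyReachable ρ (Subtype.val '' (F : Set (trace S ω).verts)) a → ρ.toEnd = w := by
  obtain ⟨F, C, hwC, hC⟩ := hw w rfl
  obtain ⟨π, rfl⟩ := Ray.toEnd_surjective w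
  rw [toEnd_mem_endsOf] at hwC
  obtain ⟨n, hn⟩ := hwC.exists
  refine ⟨F, π, (π.vert n).1, Eventually.mono hwC fun m hm => reachable_of_mem_component hlab
    (fun _ hx => Subtype.val_injective.mem_set_image.1 hx) hn hm, fun ρ hρ => hC ?_⟩
  rw [toEnd_mem_endsOf]
  exact Eventually.mono hρ fun m hm =>
    mem_component_of_reachable hlab (fun _ hx => Set.mem_image_of_mem _ hx) hn hm

/-- An infinite component of the complement of `K` in the trace contains a ray. -/
theorem exists_ray_of_infinite (hS : S.Finite) (hlab : ∀ v, (ω v).2 ∈ insert 1 S) {K : Set Γ}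
    {a : Γ} (ha : {y | (clearGraph ω K).Reachable a y}.Infinite) :
    ∃ π : Ray (trace S ω).coe, ∀ n, (clearGraph ω K).Reachable a (π.vert n).1 := by
  obtain ⟨f, hinj, h0, hadj⟩ := exists_seq_of_infinite_component (clearGraph ω K)
    (fun x => (finite_walkGraph_adj hS hlab x).subset fun y hy => hy.1) ha
  refine ⟨⟨fun n => ⟨f n, walkGraph_adj_visited (hadj n).1⟩, fun m n hmn => ?_, fun n => ?_⟩,
    fun n => ?_⟩
  · exact hinj (congrArg Subtype.val hmn)
  · exact (coe_trace_adj_iff hlab).2 (hadj n).1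
  · induction n with
    | zero => exact h0 ▸ SimpleGraph.Reachable.refl _
    | succ n ih => exact ih.trans (hadj n).reachable

/-- Every finite set of vertices of the trace is contained in a connected finite set that contains
the starting point. -/
theorem exists_connected_finset (F : Finset (trace S ω).verts) :
    ∃ K : Finset Γ, 1 ∈ K ∧ Subtype.val '' (F : Set (trace S ω).verts) ⊆ (K : Set Γ) ∧
      ∀ a ∈ K, ∀ b ∈ K, (clearGraph ω (K : Set Γ)ᶜ).Reachable a b := by
  classical
  have hvis : ∀ x : (trace S ω).verts, ∃ v, IsParticle ω v ∧ position ω v = x.1 := fun x => x.2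
  choose p hp hpos using hvis
  let K : Finset Γ := insert 1 (F.biUnion fun x => (p x).tails.toFinset.image (position ω))
  have hmem : ∀ x ∈ F, ∀ u, u <:+ p x → position ω u ∈ K := by
    intro x hx u hu
    refine Finset.mem_insert_of_mem (Finset.mem_biUnion.2 ⟨x, hx, Finset.mem_image.2 ⟨u, ?_, rfl⟩⟩)
    simpa using hu
  have hone : ∀ a ∈ K, (clearGraph ω (K : Set Γ)ᶜ).Reachable 1 a := by
    intro a ha
    rcases Finset.mem_insert.1 ha with rfl | ha
    · exact SimpleGraph.Reachable.refl _
    obtain ⟨x, hx, ha⟩ := Finset.mem_biUnion.1 ha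
    obtain ⟨u, hu, rfl⟩ := Finset.mem_image.1 ha
    have hu' : u <:+ p x := by simpa using hu
    exact reachable_position_of_suffix (isParticle_of_suffix hu' (hp x)) (List.nil_suffix)
      fun v _ hv h => h (hmem x hx v (hv.trans hu'))
  refine ⟨K, Finset.mem_insert_self _ _, ?_, fun a ha b hb => (hone a ha).symm.trans (hone b hb)⟩
  rintro _ ⟨x, hx, rfl⟩
  rw [← hpos x]
  exact hmem x hx _ List.suffix_rfl

end UBRW

namespace UBRW

open GraphEnds

variable {Γ : Type*} {ω : List ℕ → ℕ × Γ} {S : Set Γ}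

/-! ### Generations and labels -/

theorem finite_particles (ω : List ℕ → ℕ × Γ) (n : ℕ) :
    {v | IsParticle ω v ∧ v.length = n}.Finite := by
  induction n with
  | zero =>
    refine (Set.finite_singleton []).subset fun v hv => ?_
    exact List.length_eq_zero_iff.1 hv.2
  | succ n ih =>
    refine (ih.biUnion fun v _ => (Set.finite_Iio (ω v).1).image fun i => i :: v).subset ?_
    rintro (_ | ⟨i, v⟩) ⟨hv, hlen⟩
    · simp at hlen
    · exact Set.mem_biUnion (x := v) ⟨hv.2, by simpa using hlen⟩ ⟨i, hv.1, rfl⟩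

/-- Among infinitely many particles, infinitely many descend from one particle of generation `n`. -/
theorem exists_infinite_descendants {A : Set (List ℕ)} (hA : A.Infinite)
    (hpart : ∀ v ∈ A, IsParticle ω v) (n : ℕ) :
    ∃ u, IsParticle ω u ∧ u.length = n ∧ {v | v ∈ A ∧ u <:+ v}.Infinite := by
  by_contra! hno
  have hshort : {v | IsParticle ω v ∧ v.length < n}.Finite :=
    ((Set.finite_Iio n).biUnion fun k _ => finite_particles ω k).subset fun v hv =>
      Set.mem_biUnion (x := v.length) hv.2 ⟨hv.1, rfl⟩
  refine hA ((hshort.union ((finite_particles ω n).biUnion fun u hu =>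
    hno u hu.1 hu.2)).subset fun v hv => ?_)
  by_cases hlen : v.length < n
  · exact Or.inl ⟨hpart v hv, hlen⟩
  · have hsuf : v.drop (v.length - n) <:+ v := List.drop_suffix _ _
    refine Or.inr (Set.mem_biUnion (x := v.drop (v.length - n))
      ⟨isParticle_of_suffix hsuf (hpart v hv), ?_⟩ ⟨hv, hsuf⟩)
    rw [List.length_drop]
    omega

theorem ae_label_mem [MeasurableSpace Γ] [DiscreteMeasurableSpace Γ] (μ : PMF ℕ) (q : PMF Γ)
    (hq : q.support ⊆ S) : ∀ᵐ ω ∂(law μ q), ∀ v, (ω v).2 ∈ S := by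
  rw [ae_all_iff]
  intro v
  have h1 : ∀ᵐ g ∂q.toMeasure, g ∈ S := by
    rw [ae_iff, PMF.toMeasure_apply_eq_zero_iff _ MeasurableSet.of_discrete, Set.disjoint_left]
    exact fun g hg h => h (hq hg)
  exact (measurePreserving_eval_infinitePi (fun v => (offspringLaw μ v).toMeasure.prod
    q.toMeasure) v).quasiMeasurePreserving.ae (Measure.quasiMeasurePreserving_snd.ae h1)

variable [Group Γ]

/-! ### Three ends and isolated ends -/

theorem exists_three_of_three_le {α : Type*} (h : 3 ≤ ENat.card α) :
    ∃ f : Fin 3 → α, Function.Injective f := by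
  have h1 : 1 < ENat.card α := lt_of_lt_of_le (by norm_num) h
  obtain ⟨x, y, hxy⟩ := (ENat.one_lt_card_iff_nontrivial α).1 h1
  obtain ⟨z, hzx, hzy⟩ := ENat.exists_ne_ne_of_three_le h x y
  refine ⟨![x, y, z], fun i j hij => ?_⟩
  fin_cases i <;> fin_cases j <;> simp_all

/-- If the trace has three ends, then some finite connected set that contains the starting point
separates the trace into three infinite parts. -/
theorem exists_triSeparated_nil (hlab : ∀ v, (ω v).2 ∈ insert 1 S)
    (h : 3 ≤ ENat.card (Ends (trace S ω).coe)) :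
    ∃ F : Finset Γ, 1 ∈ F ∧ TriSeparated (F : Set Γ) ω [] := by
  classical
  obtain ⟨w, hw⟩ := exists_three_of_three_le h
  choose π hπ using fun i => Ray.toEnd_surjective (w i)
  have hsep : ∀ p : Fin 3 × Fin 3, ∃ F : Finset (trace S ω).verts, p.1 ≠ p.2 → ∀ a,
      ¬ (EventuallyReachable (π p.1) (Subtype.val '' (F : Set (trace S ω).verts)) a ∧
        EventuallyReachable (π p.2) (Subtype.val '' (F : Set (trace S ω).verts)) a) := by
    intro p
    by_contra! hno
    refine (hno ∅).1 (hw ?_)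
    rw [← hπ, ← hπ]
    exact toEnd_eq_of_eventuallyReachable hlab fun F => (hno F).2
  choose F hF using hsep
  obtain ⟨K, h1, hFK, hconn⟩ := exists_connected_finset (Finset.univ.biUnion F)
  have hFK' : ∀ p, Subtype.val '' (F p : Set (trace S ω).verts) ⊆ (K : Set Γ) := fun p =>
    (Set.image_mono (by exact_mod_cast Finset.subset_biUnion_of_mem F (Finset.mem_univ p))).trans
      hFK
  choose n hn using fun i => exists_eventuallyReachable hlab (π i) K
  refine ⟨K, h1, trivial, ?_⟩
  rw [position, translate_one]
  refine ⟨hconn, fun i => ((π i).vert (n i)).1, fun i => ?_, fun i j hij hr => ?_⟩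
  · obtain ⟨m, hm⟩ := eventually_atTop.1 (hn i)
    have hinj : Function.Injective fun k => ((π i).vert k).1 :=
      Subtype.val_injective.comp (π i).injective
    refine ((Set.infinite_image_iff hinj.injOn).2 (Set.Ici_infinite m)).mono ?_
    rintro _ ⟨k, hk, rfl⟩
    exact hm k hk
  · exact hF (i, j) hij _ ⟨(hn i).mono (hFK' _), ((hn j).trans hr).mono (hFK' _)⟩

theorem exists_adj_of_infinite {V : Type*} {H : SimpleGraph V} {a : V}
    (ha : {y | H.Reachable a y}.Infinite) : ∃ y, H.Adj a y := by
  obtain ⟨y, hy, hya⟩ := ha.exists_notMem_finset {a}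
  rw [Set.mem_ofPred_eq, SimpleGraph.reachable_iff_reflTransGen] at hy
  rcases Relation.ReflTransGen.cases_head hy with rfl | ⟨c, hc, -⟩
  · simp at hya
  · exact ⟨c, hc⟩

/-- Let `K` be a connected set that isolates the end `w` in the component of `a`. Then a connected
set `M` inside this component cannot separate the trace into three infinite parts: at most one of
the parts contains `K`, and the others lie in the component of `a`, where there is only one end. -/
theorem not_triSeparating_of_isolated (hS : S.Finite) (hlab : ∀ v, (ω v).2 ∈ insert 1 S)
    {w : Ends (trace S ω).coe} {K : Finset Γ} {a : Γ} (h1 : 1 ∈ K)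
    (hconn : ∀ b ∈ K, ∀ c ∈ K, (clearGraph ω (K : Set Γ)ᶜ).Reachable b c)
    (hw : ∀ ρ : Ray (trace S ω).coe, EventuallyReachable ρ K a → ρ.toEnd = w)
    {M : Finset Γ} (hMK : ∀ m ∈ M, m ∉ K) {v : List ℕ} (hv : IsParticle ω v)
    (hvM : position ω v ∈ M) (hav : (clearGraph ω K).Reachable a (position ω v)) :
    ¬ TriSeparating ω M := by
  rintro ⟨hMconn, b, hinf, hsep⟩
  have hMsub : (M : Set Γ) ⊆ (K : Set Γ)ᶜ := fun m hm => hMK m hm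
  have hKsub : (K : Set Γ) ⊆ (M : Set Γ)ᶜ := fun k hk hkM => hMK k hkM hk
  have haM : ∀ m ∈ M, (clearGraph ω K).Reachable a m := fun m hm =>
    hav.trans ((hMconn _ hvM m hm).mono (clearGraph_mono hKsub))
  -- the points of infinite components that do not contain `K` belong to the component of `a`
  have key : ∀ i, ¬ (clearGraph ω M).Reachable (b i) 1 → ∃ ρ : Ray (trace S ω).coe,
      (∀ n, (clearGraph ω M).Reachable (b i) (ρ.vert n).1) ∧ ρ.toEnd = w := by
    intro i hi
    have havoid : ∀ y, (clearGraph ω M).Reachable (b i) y → y ∉ K := fun y hy hyK =>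
      hi (hy.trans ((hconn y hyK 1 h1).mono (clearGraph_mono hMsub)))
    have hMtoK : ∀ y, (clearGraph ω M).Reachable (b i) y →
        (clearGraph ω K).Reachable (b i) y := by
      intro y hy
      have hy' := (SimpleGraph.reachable_iff_reflTransGen _ _).1 hy
      clear hy
      induction hy' with
      | refl => exact SimpleGraph.Reachable.refl _
      | @tail y z hy hyz ih =>
        rw [← SimpleGraph.reachable_iff_reflTransGen] at hy
        have hadj : (clearGraph ω K).Adj y z :=
          ⟨hyz.1, havoid y hy, havoid z (hy.trans hyz.reachable)⟩
        exact ih.trans hadj.reachable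
    obtain ⟨c, hc⟩ := exists_adj_of_infinite (hinf i)
    have hhit : ∀ y, (clearGraph ω (∅ : Set Γ)).Reachable (b i) y →
        (clearGraph ω M).Reachable (b i) y ∨ ∃ m ∈ M, (clearGraph ω K).Reachable (b i) m := by
      intro y hy
      rw [SimpleGraph.reachable_iff_reflTransGen] at hy
      induction hy with
      | refl => exact Or.inl (SimpleGraph.Reachable.refl _)
      | @tail y z _ hyz ih =>
        rcases ih with ih | ih
        · by_cases hz : z ∈ M
          · have hadj : (clearGraph ω K).Adj y z := ⟨hyz.1, havoid y ih, hMK z hz⟩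
            exact Or.inr ⟨z, hz, (hMtoK y ih).trans hadj.reachable⟩
          · have hadj : (clearGraph ω M).Adj y z := ⟨hyz.1, notMem_of_reachable ih hc.2.1, hz⟩
            exact Or.inl (ih.trans hadj.reachable)
        · exact Or.inr ih
    have hai : (clearGraph ω K).Reachable a (b i) := by
      obtain ⟨u, hu, hub⟩ := walkGraph_adj_visited hc.1
      have hpath : (clearGraph ω (∅ : Set Γ)).Reachable (b i) (position ω v) := by
        have hroot : ∀ u, IsParticle ω u →
            (clearGraph ω (∅ : Set Γ)).Reachable (position ω []) (position ω u) := fun u hu =>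
          reachable_position_of_suffix hu List.nil_suffix fun _ _ _ h => h
        rw [← hub]
        exact (hroot u hu).symm.trans (hroot v hv)
      rcases hhit _ hpath with h | ⟨m, hm, h⟩
      · exact absurd hvM (notMem_of_reachable h hc.2.1)
      · exact (haM m hm).trans h.symm
    obtain ⟨ρ, hρ⟩ := exists_ray_of_infinite hS hlab (hinf i)
    exact ⟨ρ, hρ, hw ρ (Eventually.of_forall fun n => hai.trans (hMtoK _ (hρ n)))⟩
  have htwo : ∃ i j, i ≠ j ∧ ¬ (clearGraph ω M).Reachable (b i) 1 ∧
      ¬ (clearGraph ω M).Reachable (b j) 1 := by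
    by_cases h0 : ∃ k, (clearGraph ω M).Reachable (b k) 1
    · obtain ⟨k, hk⟩ := h0
      have hne : ∀ i, i ≠ k → ¬ (clearGraph ω M).Reachable (b i) 1 := fun i hik hi =>
        hsep i k hik (hi.trans hk.symm)
      exact ⟨k + 1, k + 2, by simp, hne _ (by simp), hne _ (by simp)⟩
    · push Not at h0
      exact ⟨0, 1, by simp, h0 0, h0 1⟩
  obtain ⟨i, j, hij, hi, hj⟩ := htwo
  obtain ⟨ρ, hρ, hρw⟩ := key i hi
  obtain ⟨σ, hσ, hσw⟩ := key j hj
  obtain ⟨c, hρc, hσc⟩ := exists_eventuallyReachable_of_toEnd_eq hlab (hρw.trans hσw.symm) M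
  refine hsep i j hij ?_
  exact (EventuallyReachable.reachable (Eventually.of_forall hρ) hρc).trans
    (EventuallyReachable.reachable (Eventually.of_forall hσ) hσc).symm

/-- By transience, late particles avoid a finite set `K` that isolates an end, so that a branch that
starts late stays in one component of the complement of `K`. Some infinite branch of this kind lies
in the component of the isolated end, and it is barren. -/
theorem exists_barren_of_isIsolated (hS : S.Finite) (hlab : ∀ v, (ω v).2 ∈ insert 1 S)
    (htrans : ∀ F : Finset Γ, ∃ N : ℕ, ∀ v : List ℕ,
      IsParticle ω v → N ≤ v.length → position ω v ∉ F)
    {w : Ends (trace S ω).coe} (hw : IsIsolated w) {F : Finset Γ} (hF : 1 ∈ F) :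
    ∃ v, Barren (TriSeparated (F : Set Γ)) ω v := by
  classical
  obtain ⟨F₀, π, a₀, hπ, hiso⟩ := exists_of_isIsolated hlab hw
  obtain ⟨K, h1, hFK, hconn⟩ := exists_connected_finset F₀
  obtain ⟨n₀, ha⟩ := exists_eventuallyReachable hlab π K
  set a := (π.vert n₀).1
  have hiso' : ∀ ρ : Ray (trace S ω).coe, EventuallyReachable ρ K a → ρ.toEnd = w := fun ρ hρ =>
    hiso ρ ((hρ.mono hFK).trans (hπ.reachable (ha.mono hFK)))
  -- Translates of `F` by elements outside of this set are disjoint from `K`.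
  obtain ⟨N, hN⟩ := htrans (K ∪ (K ×ˢ F).image fun p => p.1 * p.2⁻¹)
  have hNK : ∀ v, IsParticle ω v → N ≤ v.length → position ω v ∉ K := fun v hv hlen h =>
    hN v hv hlen (Finset.mem_union_left _ h)
  have hinf : {v | IsParticle ω v ∧ (clearGraph ω K).Reachable a (position ω v)}.Infinite := by
    obtain ⟨m, hm⟩ := eventually_atTop.1 ha
    have hinj : Function.Injective fun k => (π.vert k).1 :=
      Subtype.val_injective.comp π.injective
    refine Set.Infinite.of_image (position ω)
      (((Set.infinite_image_iff hinj.injOn).2 (Set.Ici_infinite m)).mono ?_)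
    rintro _ ⟨k, hk, rfl⟩
    obtain ⟨v, hv, hvk⟩ := (π.vert k).2
    exact ⟨v, ⟨hv, hvk ▸ hm k hk⟩, hvk⟩
  obtain ⟨u, hu, hlen, huinf⟩ := exists_infinite_descendants hinf (fun v hv => hv.1) N
  have hdesc : ∀ v, IsParticle ω v → u <:+ v →
      (clearGraph ω K).Reachable (position ω u) (position ω v) := fun v hv huv =>
    reachable_position_of_suffix hv huv fun x hux hxv =>
      hNK x (isParticle_of_suffix hxv hv) (hlen ▸ hux.length_le)
  obtain ⟨v₀, ⟨hv₀, hav₀⟩, huv₀⟩ := huinf.nonempty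
  refine ⟨u, huinf.mono fun v hv => ⟨hv.1.1, hv.2⟩, fun v huv hv => ?_⟩
  have hv' : N ≤ v.length := hlen ▸ huv.length_le
  set x := position ω v with hx
  have hM : translate x (F : Set Γ) = (F.image fun f => x * f : Finset Γ) := by
    ext y
    simp only [translate, Finset.coe_image, Set.mem_image, Finset.mem_coe]
    exact ⟨fun h => ⟨_, h, by simp⟩, by rintro ⟨f, hf, rfl⟩; simpa using hf⟩
  have htri := hv.2
  rw [← hx, hM] at htri
  refine not_triSeparating_of_isolated hS hlab h1 hconn hiso' ?_ hv.1
    (Finset.mem_image.2 ⟨1, hF, by simp [hx]⟩)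
    ((hav₀.trans (hdesc v₀ hv₀ huv₀).symm).trans (hdesc v hv.1 huv)) htri
  rintro m hm hmK
  obtain ⟨f, hf, rfl⟩ := Finset.mem_image.1 hm
  refine hN v hv.1 hv' (Finset.mem_union_right _ (Finset.mem_image.2
    ⟨(x * f, f), Finset.mem_product.2 ⟨hmK, hf⟩, ?_⟩))
  simp [hx]

theorem countable_of_closure_eq_top (S : Finset Γ) (hS : Subgroup.closure (S : Set Γ) = ⊤) :
    Countable Γ := by
  have hsurj : Function.Surjective (FreeGroup.lift ((↑) : ↥(S : Set Γ) → Γ)) := by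
    rw [← MonoidHom.range_eq_top, ← FreeGroup.closure_eq_range, hS]
  exact hsurj.countable

end UBRW

theorem proposition2 {Γ : Type*} [Group Γ] [MeasurableSpace Γ] [DiscreteMeasurableSpace Γ]
    (S : Finset Γ) (hSsymm : ∀ s ∈ S, s⁻¹ ∈ S) (hSgen : Subgroup.closure (S : Set Γ) = ⊤)
    (μ : PMF ℕ) (q : PMF Γ) (hqsupp : q.support ⊆ insert 1 (S : Set Γ))
    (hqsymm : ∀ g, q g⁻¹ = q g) (htrans : UBRW.IsTransient μ q) :
    ∀ᵐ ω ∂(UBRW.law μ q),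
      3 ≤ ENat.card (GraphEnds.Ends (UBRW.trace (S : Set Γ) ω).coe) →
        ∀ w : GraphEnds.Ends (UBRW.trace (S : Set Γ) ω).coe, ¬ GraphEnds.IsIsolated w := by
  have := UBRW.countable_of_closure_eq_top S hSgen
  have hbarren : ∀ᵐ ω ∂(UBRW.law μ q), ∀ F : Finset Γ,
      UBRW.TriSeparated (F : Set Γ) ω [] →
        ∀ v, ¬ UBRW.Barren (UBRW.TriSeparated (F : Set Γ)) ω v :=
    ae_all_iff.2 fun F => (UBRW.invariant_triSeparated (F : Set Γ)).ae_not_barren μ q hqsymm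
  filter_upwards [hbarren, UBRW.ae_label_mem μ q hqsupp, htrans] with ω hω hlab htr h3 w hw
  obtain ⟨F, hF, hroot⟩ := UBRW.exists_triSeparated_nil hlab h3
  obtain ⟨v, hv⟩ := UBRW.exists_barren_of_isIsolated S.finite_toSet hlab htr hw hF
  exact hω F hroot v hv
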